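/- Fix $m\ge 0$, a norm on $\mathbb{R}^n$, and a decay function $\Gamma:\mathbb{Z}^m\to(0,\infty)$, i.e. $\sum_{k}\Gamma(k)\le 1$ and $\sum_{k}\Gamma(i-k)\Gamma(k-j)\le\Gamma(i-j)$ for all $i,j\in\mathbb{Z}^m$. Let $E=\ell^\infty(\mathbb{R}^n)$ be the space of bounded families $(x_i)_{i\in\mathbb{Z}^m}$ in $\mathbb{R}^n$ with the supremum norm. For a continuous linear map $T$ between such lattices let $\gamma(T)=\sup_{i,k}\sup\{\|(Tu)_i\|\,\Gamma(i-k)^{-1} : \|u\|\le 1,\ u_j=0 \text{ for } j\ne k\}$. For a continuous $k$-linear map $T:E^k\to E$ let $\gamma(T)=\max_{1\le p\le k}\gamma(\iota_pT)$, where $\iota_pT$ is $T$ regarded as a linear map in its $p$-th variable with values in the $(k-1)$-linear maps; explicitly, $\gamma(\iota_pT)=\sup\|T(v_1,\dots,v_k)_i\|\,\Gamma(i-l)^{-1}$ over all $i,l\in\mathbb{Z}^m$ and all $v_1,\dots,v_k$ in the closed unit ball of $E$ such that $v_p$ vanishes at every node other than $l$. Put $\|T\|_\Gamma=\max(\|T\|,\gamma(T))$,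 and let $L_\Gamma$, $L^k_\Gamma$ be the sets of linear, respectively $k$-linear, maps with $\|T\|_\Gamma<\infty$ ("$\Gamma$-decaying" maps). For $U\subset E$ open and $r\in\mathbb{N}$, $C^r_\Gamma(U,E)$ is the set of $C^r$ maps $F:U\to E$ that are bounded on $U$ and satisfy $D^kF(x)\in L^k_\Gamma$ for all $x\in U$ and $\sup_{x\in U}\|D^kF(x)\|_\Gamma<\infty$ for $1\le k\le r$. The $\Gamma$-spectrum $\operatorname{spec}_\Gamma(A)\subset\mathbb{C}$ of a continuous linear map $A:E\to E$ is the set of those $\lambda\in\mathbb{C}$ for which $A-\lambda\,\mathrm{Id}$, acting on the complexification $\ell^\infty(\mathbb{C}^n)$, does not have an inverse belonging to $L_\Gamma$. For $X\subset\mathbb{C}$, $X^j$ denotes $\{x_1\cdots x_j : x_1,\dots,x_j\in X\}$. **Theorem.** Let $r\ge 1$ be an integer, let $U\subset E$ be open with $0\in U$, and let $F\in C^r_\Gamma(U,E)$ with $F(0)=0$ and $A=DF(0)$ invertible as a continuous linear map of $E$. Let $$J=\{\,2\le j\le r : \operatorname{spec}_\Gamma(A)^j\cap\operatorname{spec}_\Gamma(A)\ne\emptyset\,\}.$$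 Then there are polynomials $K,H:E\to E$ of degree at most $r$, i.e. $K(x)=\sum_{j=0}^rK_jx^{\otimes j}$ with $K_j\in L^j_\Gamma$ and likewise for $H$, both of class $C^k_\Gamma$ on every bounded open subset of $E$ for every $k\in\mathbb{N}$, such that $K(0)=0$, $DK(0)=\mathrm{id}$, $$F\circ K(x)-K\circ H(x)=o(\|x\|^r)\quad (x\to 0),$$ and $H(x)=Ax+\sum_{j\in J}H_jx^{\otimes j}$ with $H_j\in L^j_\Gamma$ for $j\in J$. **Corollary.** In the same setting, if $\operatorname{spec}_\Gamma(A)^j\cap\operatorname{spec}_\Gamma(A)=\emptyset$ for all $2\le j\le r$, then there is a polynomial $K:E\to E$ of degree at most $r$ with coefficients in $L^j_\Gamma$, of class $C^k_\Gamma$ on every bounded open subset of $E$ for every $k\in\mathbb{N}$, such that $K(0)=0$, $DK(0)=\mathrm{id}$ and $F\circ K(x)-K(Ax)=o(\|x\|^r)$ as $x\to 0$. -/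

import Mathlib

open Set Filter Topology Asymptotics
open scoped ENNReal Pointwise

noncomputable section

namespace LatticeDecay

/-- A decay function on `ℤᵐ`: a positive function with `∑ₖ Γ(k) ≤ 1` and
`∑ₖ Γ(i-k) Γ(k-j) ≤ Γ(i-j)` for all `i`, `j`. (The second series converges because the first
one does and `0 < Γ ≤ 1`.) -/
structure IsDecayFunction {m : ℕ} (Γ : (Fin m → ℤ) → ℝ) : Prop where
  pos : ∀ k, 0 < Γ k
  summable : Summable Γ
  tsum_le_one : ∑' k, Γ k ≤ 1
  tsum_mul_le : ∀ i j, ∑' k, Γ (i - k) * Γ (k - j) ≤ Γ (i - j)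

/-- The lattice `ℓ^∞(V)` of bounded families `(x_i)` of points of the node space `V`, indexed by
`i ∈ ℤᵐ`, with the supremum norm. -/
abbrev Lattice (m : ℕ) (V : Type*) [NormedAddCommGroup V] : Type _ :=
  lp (fun _ : Fin m → ℤ => V) ∞

section Linear

variable {m : ℕ} {V W : Type*} [NormedAddCommGroup V] [NormedSpace ℝ V]
  [NormedAddCommGroup W] [NormedSpace ℝ W]

/-- `γ(T) = sup_{i,k} sup { ‖(T u)_i‖ Γ(i-k)⁻¹ : ‖u‖ ≤ 1, u_j = 0 for j ≠ k }`, for a linear map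
`T`. -/
def gammaLin (Γ : (Fin m → ℤ) → ℝ) (T : Lattice m V →L[ℝ] Lattice m W) : ℝ≥0∞ :=
  ⨆ (i : Fin m → ℤ) (k : Fin m → ℤ) (u : Lattice m V) (_ : ‖u‖ ≤ 1) (_ : ∀ j, j ≠ k → u j = 0),
    ‖(T u) i‖ₑ / ENNReal.ofReal (Γ (i - k))

/-- `‖T‖_Γ = max (‖T‖, γ(T))`. -/
def normGammaLin (Γ : (Fin m → ℤ) → ℝ) (T : Lattice m V →L[ℝ] Lattice m W) : ℝ≥0∞ :=
  max ‖T‖ₑ (gammaLin Γ T)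

/-- The set `L_Γ(ℓ^∞(V), ℓ^∞(W))` of linear maps with decay. -/
def LGamma (Γ : (Fin m → ℤ) → ℝ) : Set (Lattice m V →L[ℝ] Lattice m W) :=
  {T | normGammaLin Γ T < ∞}

/-- For a `k`-linear map `T`: `γ(T) = max_p γ(ι_p T)`, where `ι_p T` is `T` regarded as a linear
map in its `p`-th variable with values in `ℓ^∞(L^{k-1}(ℓ^∞(V), V))`. The operator norm of the
`i`-th component of `ι_p T (w)` is written out as the supremum over the remaining variables in the
unit ball; below, `v p` plays the role of `w`. -/
def gammaMulti (Γ : (Fin m → ℤ) → ℝ) {k : ℕ}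
    (T : ContinuousMultilinearMap ℝ (fun _ : Fin k => Lattice m V) (Lattice m V)) : ℝ≥0∞ :=
  ⨆ (p : Fin k) (i : Fin m → ℤ) (l : Fin m → ℤ) (v : Fin k → Lattice m V)
    (_ : ∀ q, ‖v q‖ ≤ 1) (_ : ∀ j, j ≠ l → v p j = 0),
    ‖(T v) i‖ₑ / ENNReal.ofReal (Γ (i - l))

/-- `‖T‖_Γ = max (‖T‖, γ(T))`, for a `k`-linear map `T`. -/
def normGammaMulti (Γ : (Fin m → ℤ) → ℝ) {k : ℕ}
    (T : ContinuousMultilinearMap ℝ (fun _ : Fin k => Lattice m V) (Lattice m V)) : ℝ≥0∞ :=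
  max ‖T‖ₑ (gammaMulti Γ T)

/-- The set `L^k_Γ(ℓ^∞(V), ℓ^∞(V))` of `k`-linear maps with decay. -/
def LGammaMulti (Γ : (Fin m → ℤ) → ℝ) (k : ℕ) :
    Set (ContinuousMultilinearMap ℝ (fun _ : Fin k => Lattice m V) (Lattice m V)) :=
  {T | normGammaMulti Γ T < ∞}

/-- `F ∈ C^r_Γ(U, ℓ^∞(V))` for an open set `U`: `F` is `C^r` and bounded on `U`, and for
`1 ≤ k ≤ r` the derivatives `DᵏF(x)`, `x ∈ U`, belong to `L^k_Γ` and are bounded in the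
norm `‖·‖_Γ` uniformly in `x`. Only the values of `F` on `U` matter. -/
def IsCGammaOn (Γ : (Fin m → ℤ) → ℝ) (r : ℕ) (U : Set (Lattice m V))
    (F : Lattice m V → Lattice m V) : Prop :=
  ContDiffOn ℝ r F U ∧ (⨆ x ∈ U, ‖F x‖ₑ) < ∞ ∧
    ∀ k : ℕ, 1 ≤ k → k ≤ r →
      (∀ x ∈ U, iteratedFDeriv ℝ k F x ∈ LGammaMulti Γ k) ∧
        (⨆ x ∈ U, normGammaMulti Γ (iteratedFDeriv ℝ k F x)) < ∞

/-- `F` is of class `C^∞_Γ` on every bounded open subset of `ℓ^∞(V)`. (The suprema over the whole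
space of a nonconstant polynomial are infinite.) -/
def IsCInftyGamma (Γ : (Fin m → ℤ) → ℝ) (F : Lattice m V → Lattice m V) : Prop :=
  ∀ U : Set (Lattice m V), IsOpen U → Bornology.IsBounded U → ∀ k : ℕ, IsCGammaOn Γ k U F

/-- `F` is a polynomial of degree at most `r` with decay: `F(x) = ∑_{j=0}^r c_j x^{⊗j}` with
`c_j ∈ L^j_Γ`. -/
def IsGammaPolynomial (Γ : (Fin m → ℤ) → ℝ) (r : ℕ) (F : Lattice m V → Lattice m V) : Prop :=
  ∃ c : ∀ j : ℕ, ContinuousMultilinearMap ℝ (fun _ : Fin j => Lattice m V) (Lattice m V),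
    (∀ j, c j ∈ LGammaMulti Γ j) ∧
      ∀ x, F x = ∑ j ∈ Finset.range (r + 1), c j (fun _ => x)

/-- The map `ℓ^∞(V) → ℓ^∞(W)` that applies the linear map `T : V → W` at each node. -/
def nodewise (T : V →L[ℝ] W) : Lattice m V →L[ℝ] Lattice m W :=
  LinearMap.mkContinuous
    { toFun := fun x => ⟨fun i => T (x i), memℓp_infty ⟨‖T‖ * ‖x‖, by
        rintro _ ⟨i, rfl⟩
        exact (T.le_opNorm _).trans (mul_le_mul_of_nonneg_left
          (lp.norm_apply_le_norm ENNReal.top_ne_zero x i) (norm_nonneg _))⟩⟩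
      map_add' := fun x y => by
        ext i
        exact T.map_add (x i) (y i)
      map_smul' := fun c x => by
        ext i
        exact T.map_smul c (x i) }
    ‖T‖ (fun x => lp.norm_le_of_forall_le (by positivity) fun i =>
      (T.le_opNorm _).trans (mul_le_mul_of_nonneg_left
        (lp.norm_apply_le_norm ENNReal.top_ne_zero x i) (norm_nonneg _)))

@[simp]
theorem nodewise_apply (T : V →L[ℝ] W) (x : Lattice m V) (i : Fin m → ℤ) :
    nodewise T x i = T (x i) := rfl

/-- Multiplication by `z ∈ ℂ` on the complexification `V ⊕ i V` of the node space, whose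
elements `x + i y` are written as pairs `(x, y)`. -/
def complexMul (z : ℂ) : V × V →L[ℝ] V × V :=
  (z.re • ContinuousLinearMap.fst ℝ V V - z.im • ContinuousLinearMap.snd ℝ V V).prod
    (z.im • ContinuousLinearMap.fst ℝ V V + z.re • ContinuousLinearMap.snd ℝ V V)

/-- The complexification `x + i y ↦ A x + i A y` of a linear map `A`, acting on the complexified
lattice `ℓ^∞(V) ⊕ i ℓ^∞(V) = ℓ^∞(V ⊕ i V)`. -/
def complexify (A : Lattice m V →L[ℝ] Lattice m V) :
    Lattice m (V × V) →L[ℝ] Lattice m (V × V) :=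
  nodewise (ContinuousLinearMap.inl ℝ V V) ∘L A ∘L nodewise (ContinuousLinearMap.fst ℝ V V) +
    nodewise (ContinuousLinearMap.inr ℝ V V) ∘L A ∘L nodewise (ContinuousLinearMap.snd ℝ V V)

/-- The `Γ`-resolvent set of `A`: those `z ∈ ℂ` for which `A - z Id`, acting on the complexified
lattice, has an inverse `B` in `L_Γ`. (Since `A - z Id` is complex linear, so is its inverse;
membership in `L_Γ` does not depend on the choice among equivalent norms on `V ⊕ i V`.) -/
def resolventGamma (Γ : (Fin m → ℤ) → ℝ) (A : Lattice m V →L[ℝ] Lattice m V) : Set ℂ :=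
  {z | ∃ B : Lattice m (V × V) →L[ℝ] Lattice m (V × V), B ∈ LGamma Γ ∧
    (complexify A - nodewise (complexMul z)) ∘L B = ContinuousLinearMap.id ℝ _ ∧
    B ∘L (complexify A - nodewise (complexMul z)) = ContinuousLinearMap.id ℝ _}

/-- The `Γ`-spectrum of `A`. -/
def specGamma (Γ : (Fin m → ℤ) → ℝ) (A : Lattice m V →L[ℝ] Lattice m V) : Set ℂ :=
  (resolventGamma Γ A)ᶜ

open Classical in
/-- The resonant orders `J = {2 ≤ j ≤ r : spec_Γ(A)^j ∩ spec_Γ(A) ≠ ∅}`, where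
`X^j = {x₁ ⋯ x_j : x₁, …, x_j ∈ X}`. -/
def resonantOrders (Γ : (Fin m → ℤ) → ℝ) (A : Lattice m V →L[ℝ] Lattice m V) (r : ℕ) :
    Finset ℕ :=
  (Finset.Icc 2 r).filter fun j => (specGamma Γ A ^ j ∩ specGamma Γ A).Nonempty

end Linear

end LatticeDecay

end

/-! Taylor's theorem replaces `F` by a polynomial `P` whose coefficients decay, and the conjugacy is
then solved degree by degree. Suppose `P ∘ K - K ∘ H` has order at least `s + 1`, with leading
coefficient `G`. Adding `T` to `K` and `η` to `H` in degree `s + 1` changes that coefficient to `G +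
A T - η - T (A, …, A)`. At a resonant order `T = 0`, `η = G` removes it. At a nonresonant order `η =
0`, and `A T - T (A, …, A) = -G` must be solved with a decaying `T` (`exists_sylvester`, used in
`exists_formal_conjugacy`).

On the Banach space `L^n_Γ` the operator `T ↦ A T - T (A, …, A)` equals `λ - ρ₁ ⋯ ρ_n`, where `λ`
composes with `A` on the left and `ρ_p` composes with `A` in the slot `p`. These operators commute.
Since decaying operators act on `L^n_Γ` by algebra homomorphisms, all the spectra lie in
`spec_Γ(A)`. If `λ - ρ₁ ⋯ ρ_n` were singular, a Gelfand character `f` would give `f(λ) = ∏ f(ρ_p)`,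
a point of `spec_Γ(A)^n ∩ spec_Γ(A)` (`isUnit_sub_prod_of_spectrum_subset`).

Decay is handled through `DecaysAt`, a bound by a translate of `Γ`. The inequality `Γ * Γ ≤ Γ` makes
membership in `L_Γ` equivalent to preserving such bounds, a property that is visibly stable under
composition. -/

noncomputable section

namespace LatticeDecay

/-! ### Spectra of products of commuting operators, complex and real. -/

section Spectral

/-- In a complex Banach algebra, the joint spectrum of commuting elements controls the spectrum of
polynomial expressions: here for `a - r₁ ⋯ r_j`. -/
theorem isUnit_sub_prod_of_spectrum_subset {R : Type*} [NormedRing R] [NormedAlgebra ℂ R]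
    [CompleteSpace R] {S : Set ℂ} {j : ℕ} (hS : S ^ j ∩ S = ∅) (a : R) (r : Fin j → R)
    (har : ∀ p, Commute a (r p)) (hrr : ∀ p q, Commute (r p) (r q))
    (ha : spectrum ℂ a ⊆ S) (hr : ∀ p, spectrum ℂ (r p) ⊆ S) :
    IsUnit (a - (List.ofFn r).prod) := by
  set T : Set R := insert a (range r) with hT
  have hcomm : ∀ x ∈ T, ∀ y ∈ T, x * y = y * x := by
    rintro x (rfl | ⟨p, rfl⟩) y (rfl | ⟨q, rfl⟩)
    · rfl
    · exact har q
    · exact (har p).symm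
    · exact hrr p q
  -- The bicommutant of a commuting set is commutative, closed, and contains the inverses of its
  -- elements. Gelfand theory therefore applies in `B`, while invertibility may be tested in `R`.
  set B : Subalgebra ℂ R := Subalgebra.centralizer ℂ (Set.centralizer T) with hB
  have hTB : T ⊆ B := fun x hx y hy => (hy x hx).symm
  have hTT : T ⊆ Set.centralizer T := fun x hx y hy => hcomm y hy x hx
  have hBcomm : ∀ x y : B, x * y = y * x := by
    rintro ⟨x, hx⟩ ⟨y, hy⟩
    refine Subtype.ext ?_
    exact hy x fun z hz => hx z (hTT hz)
  have hBinv : ∀ x : B, IsUnit (x : R) → IsUnit x := by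
    rintro ⟨x, hx⟩ ⟨u, rfl⟩
    have hinv : (↑u⁻¹ : R) ∈ B := fun y hy =>
      (show Commute y (u : R) from hx y hy).units_inv_right
    exact ⟨⟨⟨u, hx⟩, ⟨_, hinv⟩, Subtype.ext u.mul_inv, Subtype.ext u.inv_mul⟩, rfl⟩
  have hBclosed : IsClosed (B : Set R) := Set.isClosed_centralizer _
  have : CompleteSpace B := hBclosed.completeSpace_coe
  let : NormedCommRing B := { (inferInstance : NormedRing B) with mul_comm := hBcomm }
  set a' : B := ⟨a, hTB (mem_insert _ _)⟩
  set r' : Fin j → B := fun p => ⟨r p, hTB (mem_insert_of_mem _ ⟨p, rfl⟩)⟩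
  have key : IsUnit (a' - (List.ofFn r').prod) := by
    by_contra hnot
    obtain ⟨f, hf⟩ := WeakDual.CharacterSpace.exists_apply_eq_zero hnot
    -- A character kills `f x - x`, so this element is not a unit of `B`, hence not of `R`.
    have hspec : ∀ x : B, f x ∈ spectrum ℂ (x : R) := by
      intro x hx
      have h1 : f (algebraMap ℂ B (f x) - x) = 0 := by
        simp [map_sub, AlgHomClass.commutes]
      have h2 : IsUnit (algebraMap ℂ B (f x) - x) := hBinv _ hx
      exact (h2.map f).ne_zero h1
    have h1 : f a' = ∏ p, f (r' p) := by
      have := hf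
      rw [map_sub, sub_eq_zero, map_list_prod, List.map_ofFn, List.prod_ofFn] at this
      exact this
    have h2 : f a' ∈ S ^ j ∩ S := by
      refine ⟨?_, ha (hspec a')⟩
      rw [h1]
      have : ∏ p, f (r' p) ∈ ∏ _p : Fin j, S :=
        Set.finsetProd_mem_finsetProd _ _ _ fun p _ => hr p (hspec (r' p))
      simpa using this
    rw [hS] at h2
    exact h2
  have := key.map B.val
  rw [map_sub, map_list_prod, List.map_ofFn] at this
  exact this

variable (X : Type*) [NormedAddCommGroup X] [NormedSpace ℝ X]

/-- The complexification of a real normed space, realized as the space of real-linear maps from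
`ℂ`, on which `ℂ` acts through the argument. -/
def Complexification : Type _ := ℂ →L[ℝ] X

namespace Complexification

instance : NormedAddCommGroup (Complexification X) :=
  inferInstanceAs (NormedAddCommGroup (ℂ →L[ℝ] X))

instance [CompleteSpace X] : CompleteSpace (Complexification X) :=
  inferInstanceAs (CompleteSpace (ℂ →L[ℝ] X))

variable {X}

instance : SMul ℂ (Complexification X) :=
  ⟨fun z f => ContinuousLinearMap.comp (f : ℂ →L[ℝ] X) (ContinuousLinearMap.mul ℝ ℂ z)⟩

theorem smul_apply (z : ℂ) (f : Complexification X) (w : ℂ) :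
    (show ℂ →L[ℝ] X from z • f) w = (show ℂ →L[ℝ] X from f) (z * w) := rfl

theorem add_apply (f g : Complexification X) (w : ℂ) :
    (show ℂ →L[ℝ] X from f + g) w = (show ℂ →L[ℝ] X from f) w + (show ℂ →L[ℝ] X from g) w := rfl

@[ext]
theorem ext {f g : Complexification X}
    (h : ∀ w, (show ℂ →L[ℝ] X from f) w = (show ℂ →L[ℝ] X from g) w) : f = g :=
  ContinuousLinearMap.ext h

instance : Module ℂ (Complexification X) where
  one_smul f := by ext w; rw [smul_apply, one_mul]
  mul_smul z z' f := by
    ext w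
    rw [smul_apply, smul_apply, smul_apply]
    congr 1
    ring
  smul_zero z := rfl
  smul_add z f g := rfl
  add_smul z z' f := by
    ext w
    rw [add_apply, smul_apply, smul_apply, smul_apply, add_mul, map_add]
  zero_smul f := by
    ext w
    rw [smul_apply, zero_mul, map_zero]
    rfl

instance : NormedSpace ℂ (Complexification X) where
  -- Multiplication by `z` on `ℂ` has norm `|z|`, so the operator norm is already complex
  -- homogeneous; the maximum norm on pairs is not.
  norm_smul_le z f := by
    refine ContinuousLinearMap.opNorm_le_bound _ (by positivity) fun w => ?_
    rw [smul_apply]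
    refine (ContinuousLinearMap.le_opNorm _ _).trans (le_of_eq ?_)
    rw [norm_mul]
    change ‖f‖ * _ = _
    ring

/-- The complexification of a real-linear operator. -/
def mapCLM (T : X →L[ℝ] X) : Complexification X →L[ℂ] Complexification X :=
  LinearMap.mkContinuous
    { toFun := fun f => T.comp (show ℂ →L[ℝ] X from f)
      map_add' := fun f g => by
        ext w
        exact T.map_add _ _
      map_smul' := fun z f => rfl }
    ‖T‖ fun f => ContinuousLinearMap.opNorm_comp_le _ _

/-- Complexification of operators is a ring homomorphism. -/
def map : (X →L[ℝ] X) →+* (Complexification X →L[ℂ] Complexification X) where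
  toFun := mapCLM
  map_one' := rfl
  map_mul' _ _ := rfl
  map_zero' := rfl
  map_add' _ _ := rfl

theorem map_smul (c : ℝ) (T : X →L[ℝ] X) : map (c • T) = (c : ℂ) • map T := by
  ext f w
  change c • T ((show ℂ →L[ℝ] X from f) w) = T ((show ℂ →L[ℝ] X from f) (c * w))
  rw [← T.map_smul, ← ContinuousLinearMap.map_smul]
  simp

/-- The real vector `y` is embedded as `w ↦ re w • y`; evaluating its complex preimage at `1` gives
a real preimage. -/
theorem surjective_of_isUnit_map {T : X →L[ℝ] X} (h : IsUnit (map T)) :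
    Function.Surjective T := by
  intro y
  obtain ⟨u, hu⟩ := h
  set f : Complexification X := Complex.reCLM.smulRight y
  have h1 : map T ((↑u⁻¹ : Complexification X →L[ℂ] Complexification X) f) = f := by
    rw [← hu]
    exact DFunLike.congr_fun u.mul_inv f
  refine ⟨(show ℂ →L[ℝ] X from (↑u⁻¹ : Complexification X →L[ℂ] Complexification X) f) 1, ?_⟩
  have h2 := congrArg (fun g : Complexification X => (show ℂ →L[ℝ] X from g) 1) h1
  refine h2.trans ?_
  change Complex.reCLM 1 • y = y
  simp

/-- A complex number `z` for which `(T - re z)² + (im z)²` is invertible is not in the spectrum of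
the complexification of `T`. -/
theorem spectrum_map_subset {S : Set ℂ} {T : X →L[ℝ] X}
    (hT : ∀ z ∉ S, IsUnit ((T - z.re • (1 : X →L[ℝ] X)) ^ 2 + (z.im ^ 2) • (1 : X →L[ℝ] X))) :
    spectrum ℂ (map T) ⊆ S := by
  intro z hz
  by_contra hzS
  apply hz
  have h := (hT z hzS).map (map (X := X))
  -- Over `ℂ` the real quadratic splits into the commuting factors `z - T` and `z̄ - T`; if the
  -- product is a unit, so is each factor.
  have hfac : map ((T - z.re • (1 : X →L[ℝ] X)) ^ 2 + (z.im ^ 2) • (1 : X →L[ℝ] X)) =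
      (algebraMap ℂ _ z - map T) * (algebraMap ℂ _ (starRingEnd ℂ z) - map T) := by
    have e2 : starRingEnd ℂ z + z = ((2 * z.re : ℝ) : ℂ) := by
      rw [add_comm]; exact Complex.add_conj z
    have e3 : z * starRingEnd ℂ z = ((z.re ^ 2 + z.im ^ 2 : ℝ) : ℂ) := by
      rw [Complex.mul_conj, Complex.normSq_apply]; push_cast; ring
    have e4 : (T - z.re • (1 : X →L[ℝ] X)) ^ 2 + (z.im ^ 2) • (1 : X →L[ℝ] X) =
        T * T - (2 * z.re) • T + (z.re ^ 2 + z.im ^ 2) • 1 := by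
      rw [pow_two, sub_mul, mul_sub, mul_sub, smul_mul_assoc, smul_mul_assoc, mul_smul_comm,
        one_mul, one_mul, mul_one]
      module
    rw [e4, map_add, map_sub, map_smul, map_smul, map_one, map_mul, ← e2, ← e3,
      Algebra.algebraMap_eq_smul_one, Algebra.algebraMap_eq_smul_one]
    simp only [sub_mul, mul_sub, smul_mul_assoc, mul_smul_comm, one_mul, mul_one]
    module
  rw [hfac] at h
  have hc : Commute (algebraMap ℂ (Complexification X →L[ℂ] Complexification X) z - map T)
      (algebraMap ℂ _ (starRingEnd ℂ z) - map T) :=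
    ((Algebra.commute_algebraMap_left _ _).sub_right (Algebra.commute_algebraMap_left _ _)).sub_left
      ((Algebra.commute_algebraMap_right _ _).sub_right (Commute.refl _))
  exact (hc.isUnit_mul_iff.1 h).1

end Complexification

/-- Surjectivity of `a - r₁ ⋯ r_j` for commuting operators on a real Banach space. -/
theorem surjective_sub_prod {X : Type*} [NormedAddCommGroup X] [NormedSpace ℝ X] [CompleteSpace X]
    {S : Set ℂ} {j : ℕ} (hS : S ^ j ∩ S = ∅) (a : X →L[ℝ] X) (r : Fin j → X →L[ℝ] X)
    (har : ∀ p, Commute a (r p)) (hrr : ∀ p q, Commute (r p) (r q))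
    (ha : ∀ z ∉ S, IsUnit ((a - z.re • (1 : X →L[ℝ] X)) ^ 2 + (z.im ^ 2) • (1 : X →L[ℝ] X)))
    (hr : ∀ p, ∀ z ∉ S,
      IsUnit ((r p - z.re • (1 : X →L[ℝ] X)) ^ 2 + (z.im ^ 2) • (1 : X →L[ℝ] X))) :
    Function.Surjective (a - (List.ofFn r).prod) := by
  apply Complexification.surjective_of_isUnit_map
  rw [map_sub, map_list_prod, List.map_ofFn]
  exact isUnit_sub_prod_of_spectrum_subset hS _ _ (fun p => (har p).map _)
    (fun p q => (hrr p q).map _) (Complexification.spectrum_map_subset ha)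
    fun p => Complexification.spectrum_map_subset (hr p)

end Spectral

/-! ### Decaying families, and the maps that preserve them. -/

section Decay

set_option linter.unusedSectionVars false

variable {m : ℕ} {V W : Type*} [NormedAddCommGroup V] [NormedSpace ℝ V]
  [NormedAddCommGroup W] [NormedSpace ℝ W] {Γ : (Fin m → ℤ) → ℝ}

/-- `x` decays away from the node `l`, with constant `c`. -/
def DecaysAt (Γ : (Fin m → ℤ) → ℝ) (l : Fin m → ℤ) (c : ℝ) (x : Lattice m V) : Prop :=
  ∀ k, ‖x k‖ ≤ c * Γ (k - l)

/-- A linear map is decaying if it maps decaying families to decaying families, uniformly. -/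
def IsDecayingLin (Γ : (Fin m → ℤ) → ℝ) (T : Lattice m V →L[ℝ] Lattice m W) : Prop :=
  ∃ C : ℝ, 0 ≤ C ∧ ∀ l c x, DecaysAt Γ l c x → DecaysAt Γ l (C * c) (T x)

/-- A multilinear map is decaying if, as a function of each of its arguments, it maps decaying
families to decaying families, uniformly for arguments in bounded sets. -/
def IsDecaying (Γ : (Fin m → ℤ) → ℝ) {ι : Type*}
    (T : ContinuousMultilinearMap ℝ (fun _ : ι => Lattice m V) (Lattice m V)) : Prop :=
  ∀ R : ℝ, ∃ C : ℝ, 0 ≤ C ∧ ∀ v : ι → Lattice m V, (∀ q, ‖v q‖ ≤ R) →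
    ∀ p l c, DecaysAt Γ l c (v p) → DecaysAt Γ l (C * c) (T v)

theorem DecaysAt.nonneg (hΓ : IsDecayFunction Γ) {l : Fin m → ℤ} {c : ℝ} {x : Lattice m V}
    (hx : DecaysAt Γ l c x) : 0 ≤ c :=
  nonneg_of_mul_nonneg_left ((norm_nonneg _).trans (hx l)) (hΓ.pos _)

theorem DecaysAt.mono (hΓ : IsDecayFunction Γ) {l : Fin m → ℤ} {c c' : ℝ} {x : Lattice m V}
    (hx : DecaysAt Γ l c x) (h : c ≤ c') : DecaysAt Γ l c' x := fun k =>
  (hx k).trans (mul_le_mul_of_nonneg_right h (hΓ.pos _).le)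

theorem DecaysAt.add {l : Fin m → ℤ} {c c' : ℝ} {x y : Lattice m V}
    (hx : DecaysAt Γ l c x) (hy : DecaysAt Γ l c' y) : DecaysAt Γ l (c + c') (x + y) := fun k => by
  rw [add_mul]
  exact (norm_add_le _ _).trans (add_le_add (hx k) (hy k))

theorem DecaysAt.smul {l : Fin m → ℤ} {c : ℝ} {x : Lattice m V}
    (hx : DecaysAt Γ l c x) (a : ℝ) : DecaysAt Γ l (|a| * c) (a • x) := fun k => by
  rw [lp.coeFn_smul, Pi.smul_apply, norm_smul, mul_assoc]
  exact mul_le_mul_of_nonneg_left (hx k) (abs_nonneg a)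

/-- The factor `(Γ 0)⁻¹` makes the bound equal to `1` at the supporting node. -/
theorem DecaysAt.of_support (hΓ : IsDecayFunction Γ) {l : Fin m → ℤ} {x : Lattice m V}
    (hx : ‖x‖ ≤ 1) (hl : ∀ j, j ≠ l → x j = 0) : DecaysAt Γ l (Γ 0)⁻¹ x := by
  intro k
  by_cases hk : k = l
  · subst hk
    rw [sub_self, inv_mul_cancel₀ (hΓ.pos 0).ne']
    exact (lp.norm_apply_le_norm ENNReal.top_ne_zero x k).trans hx
  · rw [hl k hk, norm_zero]
    exact mul_nonneg (inv_nonneg.2 (hΓ.pos 0).le) (hΓ.pos _).le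

theorem IsDecayFunction.summable_sub_right (hΓ : IsDecayFunction Γ) (l : Fin m → ℤ) :
    Summable fun k => Γ (k - l) :=
  (Equiv.subRight l).summable_iff.2 hΓ.summable

theorem IsDecayFunction.le_one (hΓ : IsDecayFunction Γ) (k : Fin m → ℤ) : Γ k ≤ 1 :=
  (hΓ.summable.le_tsum k fun j _ => (hΓ.pos j).le).trans hΓ.tsum_le_one

theorem IsDecayFunction.summable_mul (hΓ : IsDecayFunction Γ) (i l : Fin m → ℤ) :
    Summable fun k => Γ (i - k) * Γ (k - l) :=
  Summable.of_nonneg_of_le (fun _ => mul_nonneg (hΓ.pos _).le (hΓ.pos _).le)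
    (fun _ => mul_le_of_le_one_left (hΓ.pos _).le (hΓ.le_one _)) (hΓ.summable_sub_right l)

theorem lattice_single_apply (k i : Fin m → ℤ) (a : V) :
    (lp.single (E := fun _ : Fin m → ℤ => V) ∞ k a) i = if i = k then a else 0 := by
  rw [lp.single_apply, Pi.single_apply]

/-- A decaying family is the norm limit of its truncations to finitely many nodes. -/
theorem DecaysAt.hasSum_single (hΓ : IsDecayFunction Γ) {l : Fin m → ℤ} {c : ℝ} {x : Lattice m V}
    (hx : DecaysAt Γ l c x) :
    HasSum (fun k => lp.single (E := fun _ : Fin m → ℤ => V) ∞ k (x k)) x := by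
  have hc := hx.nonneg hΓ
  rw [HasSum, SummationFilter.unconditional_filter, Metric.tendsto_nhds]
  intro ε hε
  -- Summability forces `Γ` to vanish at infinity. This gives convergence in the supremum norm,
  -- which fails for general bounded families.
  have h0 : Tendsto (fun k => c * Γ (k - l)) cofinite (𝓝 0) :=
    ((hΓ.summable_sub_right l).mul_left c).tendsto_cofinite_zero
  have hfin : {k | ¬ c * Γ (k - l) < ε / 2}.Finite := h0.eventually (gt_mem_nhds (half_pos hε))
  filter_upwards [eventually_ge_atTop hfin.toFinset] with s hs
  rw [dist_comm, dist_eq_norm]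
  refine (lp.norm_le_of_forall_le (half_pos hε).le fun i => ?_).trans_lt (half_lt_self hε)
  rw [lp.coeFn_sub, Pi.sub_apply, lp.coeFn_sum, Finset.sum_apply]
  simp only [lattice_single_apply, Finset.sum_ite_eq]
  split_ifs with hi
  · rw [sub_self, norm_zero]
    exact (half_pos hε).le
  · rw [sub_zero]
    refine (hx i).trans (le_of_lt ?_)
    by_contra hcon
    exact hi (hs (hfin.mem_toFinset.2 hcon))

/-- A continuous linear map with decaying matrix entries preserves decaying families. -/
theorem DecaysAt.map_of_single (hΓ : IsDecayFunction Γ) {g : Lattice m V →L[ℝ] Lattice m W} {M : ℝ}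
    (hg : ∀ k (a : V) i, ‖g (lp.single ∞ k a) i‖ ≤ M * ‖a‖ * Γ (i - k)) (hM : 0 ≤ M)
    {l : Fin m → ℤ} {c : ℝ} {x : Lattice m V} (hx : DecaysAt Γ l c x) :
    DecaysAt Γ l (M * c) (g x) := by
  intro i
  have hc := hx.nonneg hΓ
  have h1 : HasSum (fun k => g (lp.single ∞ k (x k)) i) (g x i) :=
    (hx.hasSum_single hΓ).mapL
      ((lp.evalCLM ℝ (fun _ : Fin m → ℤ => W) ∞ i).comp g)
  -- Matrix entries times components are dominated by the convolution of `Γ` with itself, which is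
  -- at most `Γ`; so the rate of decay is not lost.
  have h2 : HasSum (fun k => M * c * (Γ (i - k) * Γ (k - l)))
      (M * c * ∑' k, Γ (i - k) * Γ (k - l)) := (hΓ.summable_mul i l).hasSum.mul_left _
  have h3 := tsum_of_norm_bounded h2 fun k => (hg k (x k) i).trans <| by
    have := hx k
    have h4 : M * ‖x k‖ * Γ (i - k) ≤ M * (c * Γ (k - l)) * Γ (i - k) :=
      mul_le_mul_of_nonneg_right (mul_le_mul_of_nonneg_left this hM) (hΓ.pos _).le
    refine h4.trans (le_of_eq (by ring))
  rw [h1.tsum_eq] at h3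
  exact h3.trans (mul_le_mul_of_nonneg_left (hΓ.tsum_mul_le i l) (mul_nonneg hM hc))

theorem norm_lattice_single (k : Fin m → ℤ) (a : V) :
    ‖lp.single (E := fun _ : Fin m → ℤ => V) ∞ k a‖ = ‖a‖ :=
  lp.norm_single (E := fun _ : Fin m → ℤ => V) ENNReal.zero_lt_top k a

theorem le_of_enorm_div_le {a g : ℝ} (hg : 0 < g) {w : W} {B : ℝ≥0∞} (hB : B ≠ ∞)
    (h : ‖w‖ₑ / ENNReal.ofReal g ≤ B) (ha : a = B.toReal) : ‖w‖ ≤ a * g := by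
  subst ha
  have h1 : ‖w‖ₑ ≤ B * ENNReal.ofReal g :=
    (ENNReal.div_le_iff (by simpa using hg) ENNReal.ofReal_ne_top).1 h
  have h2 := ENNReal.toReal_mono (ENNReal.mul_ne_top hB ENNReal.ofReal_ne_top) h1
  rwa [toReal_enorm, ENNReal.toReal_mul, ENNReal.toReal_ofReal hg.le] at h2

theorem enorm_div_le {a g : ℝ} (hg : 0 < g) {w : W} (h : ‖w‖ ≤ a * g) :
    ‖w‖ₑ / ENNReal.ofReal g ≤ ENNReal.ofReal a := by
  rw [ENNReal.div_le_iff (by simpa using hg) ENNReal.ofReal_ne_top, ← ENNReal.ofReal_mul' hg.le,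
    ← ofReal_norm]
  exact ENNReal.ofReal_le_ofReal h

/-- Finiteness of `γ(T)` bounds the action on families supported at one node, which is the input of
`DecaysAt.map_of_single`. -/
theorem isDecayingLin_of_mem_LGamma (hΓ : IsDecayFunction Γ) {T : Lattice m V →L[ℝ] Lattice m W}
    (hT : T ∈ LGamma Γ) : IsDecayingLin Γ T := by
  have hfin : gammaLin Γ T ≠ ∞ := ((le_max_right _ _).trans_lt hT).ne
  refine ⟨(gammaLin Γ T).toReal, ENNReal.toReal_nonneg, fun l c x hx =>
    hx.map_of_single hΓ (fun k a i => ?_) ENNReal.toReal_nonneg⟩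
  rcases eq_or_ne a 0 with rfl | ha
  · simp
  have ha' : 0 < ‖a‖ := norm_pos_iff.2 ha
  set u : Lattice m V := ‖a‖⁻¹ • lp.single ∞ k a with hu
  have hu1 : ‖u‖ ≤ 1 := by
    rw [hu, norm_smul, norm_lattice_single, norm_inv, norm_norm, inv_mul_cancel₀ ha'.ne']
  have hu2 : ∀ j, j ≠ k → u j = 0 := by
    intro j hj
    rw [hu, lp.coeFn_smul, Pi.smul_apply, lattice_single_apply, if_neg hj, smul_zero]
  have h1 : ‖(T u) i‖ₑ / ENNReal.ofReal (Γ (i - k)) ≤ gammaLin Γ T :=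
    le_iSup_of_le i <| le_iSup_of_le k <| le_iSup_of_le u <| le_iSup_of_le hu1 <|
      le_iSup_of_le hu2 le_rfl
  have h2 := le_of_enorm_div_le (hΓ.pos _) hfin h1 rfl
  have h3 : (T (lp.single ∞ k a)) = ‖a‖ • T u := by
    rw [← T.map_smul, hu, smul_smul, mul_inv_cancel₀ ha'.ne', one_smul]
  rw [h3, lp.coeFn_smul, Pi.smul_apply, norm_smul, norm_norm]
  calc ‖a‖ * ‖(T u) i‖ ≤ ‖a‖ * ((gammaLin Γ T).toReal * Γ (i - k)) := by gcongr
    _ = _ := by ring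

variable {n : ℕ}

/-- Together with the converse `IsDecaying.mem_LGammaMulti`, this allows `L^n_Γ` to be replaced by
`IsDecaying` throughout. -/
theorem isDecaying_of_mem_LGammaMulti (hΓ : IsDecayFunction Γ)
    {T : ContinuousMultilinearMap ℝ (fun _ : Fin n => Lattice m V) (Lattice m V)}
    (hT : T ∈ LGammaMulti Γ n) : IsDecaying Γ T := by
  have hfin : gammaMulti Γ T ≠ ∞ := ((le_max_right _ _).trans_lt hT).ne
  intro R
  -- The radius is raised to at least `1` so that it can be inverted and `R' ^ n` dominates the
  -- rescaling factors of the slots other than `p`.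
  set R' := max R 1 with hR'
  have hR1 : 1 ≤ R' := le_max_right _ _
  have hR0 : 0 < R' := zero_lt_one.trans_le hR1
  set G := (gammaMulti Γ T).toReal with hG
  have hG0 : 0 ≤ G := ENNReal.toReal_nonneg
  refine ⟨R' ^ n * G, by positivity, fun v hv p l c hp => ?_⟩
  -- With the other arguments frozen, `T` is a continuous linear map in the slot `p`, and the linear
  -- criterion applies.
  have hup : T v = T.toContinuousLinearMap v p (v p) := by
    change T v = T (Function.update v p (v p))
    rw [Function.update_eq_self]
  rw [hup]
  refine hp.map_of_single hΓ (fun k a i => ?_) (by positivity)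
  change ‖T (Function.update v p (lp.single ∞ k a)) i‖ ≤ _
  rcases eq_or_ne a 0 with rfl | ha
  · rw [lp.single_zero, T.map_coord_zero p (Function.update_self ..)]
    simp
  have ha' : 0 < ‖a‖ := norm_pos_iff.2 ha
  set w : Fin n → Lattice m V :=
    Function.update (fun q => R'⁻¹ • v q) p (‖a‖⁻¹ • lp.single ∞ k a) with hw
  have hwp : w p = ‖a‖⁻¹ • lp.single ∞ k a := Function.update_self ..
  have hw1 : ∀ q, ‖w q‖ ≤ 1 := by
    intro q
    rcases eq_or_ne q p with rfl | hq
    · rw [hwp, norm_smul, norm_lattice_single, norm_inv, norm_norm, inv_mul_cancel₀ ha'.ne']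
    · rw [hw, Function.update_of_ne hq, norm_smul, norm_inv, Real.norm_of_nonneg hR0.le,
        inv_mul_le_one₀ hR0]
      exact (hv q).trans (le_max_left _ _)
  have hw2 : ∀ j, j ≠ k → w p j = 0 := by
    intro j hj
    rw [hwp, lp.coeFn_smul, Pi.smul_apply, lattice_single_apply, if_neg hj, smul_zero]
  have h1 : ‖(T w) i‖ₑ / ENNReal.ofReal (Γ (i - k)) ≤ gammaMulti Γ T :=
    le_iSup_of_le p <| le_iSup_of_le i <| le_iSup_of_le k <| le_iSup_of_le w <|
      le_iSup_of_le hw1 <| le_iSup_of_le hw2 le_rfl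
  have h2 := le_of_enorm_div_le (hΓ.pos _) hfin h1 rfl
  set s : Fin n → ℝ := Function.update (fun _ => R') p ‖a‖ with hs
  have h3 : Function.update v p (lp.single ∞ k a) = fun q => s q • w q := by
    funext q
    rcases eq_or_ne q p with rfl | hq
    · rw [hwp, hs, Function.update_self, Function.update_self, smul_smul, mul_inv_cancel₀ ha'.ne',
        one_smul]
    · rw [hs, hw, Function.update_of_ne hq, Function.update_of_ne hq, Function.update_of_ne hq,
        smul_smul, mul_inv_cancel₀ hR0.ne', one_smul]
  have h4 : ∏ q, s q ≤ ‖a‖ * R' ^ n := by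
    rw [hs, Finset.prod_update_of_mem (Finset.mem_univ p), Finset.prod_const]
    gcongr
    exact (Finset.card_le_univ _).trans (by simp)
  have h5 : 0 ≤ ∏ q, s q := Finset.prod_nonneg fun q _ => by
    rcases eq_or_ne q p with rfl | hq
    · rw [hs, Function.update_self]
      exact ha'.le
    · rw [hs, Function.update_of_ne hq]
      exact hR0.le
  rw [h3, T.map_smul_univ, lp.coeFn_smul, Pi.smul_apply, norm_smul, Real.norm_of_nonneg h5]
  calc (∏ q, s q) * ‖(T w) i‖ ≤ (‖a‖ * R' ^ n) * (G * Γ (i - k)) := by gcongr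
    _ = _ := by ring

theorem norm_le_of_unit_ball {E G : Type*} [NormedAddCommGroup E] [NormedSpace ℝ E]
    [NormedAddCommGroup G] [NormedSpace ℝ G] (T : ContinuousMultilinearMap ℝ (fun _ : Fin n => E) G)
    {B : ℝ} (hB : 0 ≤ B) (h : ∀ v, (∀ q, ‖v q‖ ≤ 1) → ‖T v‖ ≤ B) : ‖T‖ ≤ B := by
  refine ContinuousMultilinearMap.opNorm_le_bound hB fun v => ?_
  by_cases hv : ∃ q, v q = 0
  · obtain ⟨q, hq⟩ := hv
    rw [T.map_coord_zero q hq, norm_zero]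
    exact mul_nonneg hB (Finset.prod_nonneg fun _ _ => norm_nonneg _)
  · push Not at hv
    have h1 : v = fun q => ‖v q‖ • (‖v q‖⁻¹ • v q) := by
      funext q
      rw [smul_smul, mul_inv_cancel₀ (norm_ne_zero_iff.2 (hv q)), one_smul]
    have h2 : ‖T fun q => ‖v q‖⁻¹ • v q‖ ≤ B := h _ fun q => by
      rw [norm_smul, norm_inv, norm_norm, inv_mul_cancel₀ (norm_ne_zero_iff.2 (hv q))]
    conv_lhs => rw [h1]
    rw [T.map_smul_univ, norm_smul, Real.norm_of_nonneg (Finset.prod_nonneg fun _ _ => norm_nonneg _),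
      mul_comm]
    gcongr

/-- A bound for `‖T‖_Γ` in terms of the action of `T` on the unit ball. -/
theorem normGammaMulti_le (hΓ : IsDecayFunction Γ)
    {T : ContinuousMultilinearMap ℝ (fun _ : Fin n => Lattice m V) (Lattice m V)} {B : ℝ}
    (hB : 0 ≤ B) (h : ∀ v, (∀ q, ‖v q‖ ≤ 1) → ‖T v‖ ≤ B)
    (hd : ∀ v, (∀ q, ‖v q‖ ≤ 1) → ∀ p l c, DecaysAt Γ l c (v p) → DecaysAt Γ l (B * c) (T v)) :
    normGammaMulti Γ T ≤ ENNReal.ofReal (max B (B * (Γ 0)⁻¹)) := by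
  refine max_le ?_ ?_
  · rw [← ofReal_norm]
    exact ENNReal.ofReal_le_ofReal ((norm_le_of_unit_ball T hB h).trans (le_max_left _ _))
  · refine iSup_le fun p => iSup_le fun i => iSup_le fun l => iSup_le fun v => iSup_le fun hv =>
      iSup_le fun hl => ?_
    refine (enorm_div_le (hΓ.pos _) (hd v hv p l _ (DecaysAt.of_support hΓ (hv p) hl) i)).trans ?_
    exact ENNReal.ofReal_le_ofReal (le_max_right _ _)

theorem IsDecaying.mem_LGammaMulti (hΓ : IsDecayFunction Γ)
    {T : ContinuousMultilinearMap ℝ (fun _ : Fin n => Lattice m V) (Lattice m V)}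
    (hT : IsDecaying Γ T) : T ∈ LGammaMulti Γ n := by
  obtain ⟨C, hC, h⟩ := hT 1
  refine (normGammaMulti_le hΓ (B := max C ‖T‖) (le_max_of_le_left hC) (fun v hv => ?_)
    fun v hv p l c hp => ?_).trans_lt ENNReal.ofReal_lt_top
  · refine (T.le_opNorm v).trans (le_max_of_le_right (mul_le_of_le_one_right (norm_nonneg _) ?_))
    exact Finset.prod_le_one (fun _ _ => norm_nonneg _) fun q _ => hv q
  · exact (h v hv p l c hp).mono hΓ
      (mul_le_mul_of_nonneg_right (le_max_left _ _) (hp.nonneg hΓ))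

end Decay

/-! ### From the complex resolvent to real decaying inverses. -/

section Resolvent

set_option linter.unusedSectionVars false

variable {m : ℕ} {V W Z : Type*} [NormedAddCommGroup V] [NormedSpace ℝ V]
  [NormedAddCommGroup W] [NormedSpace ℝ W] [NormedAddCommGroup Z] [NormedSpace ℝ Z]
  {Γ : (Fin m → ℤ) → ℝ}

theorem IsDecayingLin.comp {S : Lattice m W →L[ℝ] Lattice m Z} {T : Lattice m V →L[ℝ] Lattice m W}
    (hS : IsDecayingLin Γ S) (hT : IsDecayingLin Γ T) : IsDecayingLin Γ (S ∘L T) := by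
  obtain ⟨C, hC, h⟩ := hS
  obtain ⟨D, hD, k⟩ := hT
  refine ⟨C * D, mul_nonneg hC hD, fun l c x hx => ?_⟩
  rw [mul_assoc]
  exact h _ _ _ (k _ _ _ hx)

theorem IsDecayingLin.add {S T : Lattice m V →L[ℝ] Lattice m W}
    (hS : IsDecayingLin Γ S) (hT : IsDecayingLin Γ T) : IsDecayingLin Γ (S + T) := by
  obtain ⟨C, hC, h⟩ := hS
  obtain ⟨D, hD, k⟩ := hT
  refine ⟨C + D, add_nonneg hC hD, fun l c x hx => ?_⟩
  rw [add_mul]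
  exact (h _ _ _ hx).add (k _ _ _ hx)

theorem IsDecayingLin.smul {S : Lattice m V →L[ℝ] Lattice m W}
    (hS : IsDecayingLin Γ S) (a : ℝ) : IsDecayingLin Γ (a • S) := by
  obtain ⟨C, hC, h⟩ := hS
  refine ⟨|a| * C, by positivity, fun l c x hx => ?_⟩
  rw [mul_assoc]
  exact (h _ _ _ hx).smul a

theorem isDecayingLin_id : IsDecayingLin Γ (ContinuousLinearMap.id ℝ (Lattice m V)) :=
  ⟨1, zero_le_one, fun l c x hx => by rwa [one_mul]⟩

theorem isDecayingLin_nodewise (T : V →L[ℝ] W) :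
    IsDecayingLin Γ (nodewise T : Lattice m V →L[ℝ] Lattice m W) := by
  refine ⟨‖T‖, norm_nonneg _, fun l c x hx k => ?_⟩
  rw [nodewise_apply, mul_assoc]
  exact T.le_opNorm_of_le (hx k)

/-- The decaying linear operators form an algebra. -/
def decayingSubalgebra (Γ : (Fin m → ℤ) → ℝ) (V : Type*) [NormedAddCommGroup V] [NormedSpace ℝ V] :
    Subalgebra ℝ (Lattice m V →L[ℝ] Lattice m V) where
  carrier := {T | IsDecayingLin Γ T}
  mul_mem' := fun hS hT => hS.comp hT
  add_mem' := fun hS hT => hS.add hT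
  algebraMap_mem' := fun a => isDecayingLin_id.smul a

/-- Real parts, node by node. -/
abbrev rePart : Lattice m (V × V) →L[ℝ] Lattice m V := nodewise (ContinuousLinearMap.fst ℝ V V)

/-- Imaginary parts, node by node. -/
abbrev imPart : Lattice m (V × V) →L[ℝ] Lattice m V := nodewise (ContinuousLinearMap.snd ℝ V V)

/-- The real families inside the complexified lattice. -/
abbrev ofRealPart : Lattice m V →L[ℝ] Lattice m (V × V) := nodewise (ContinuousLinearMap.inl ℝ V V)

/-- Complex conjugation on the complexified lattice. -/
abbrev conjPart : Lattice m (V × V) →L[ℝ] Lattice m (V × V) :=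
  nodewise ((ContinuousLinearMap.fst ℝ V V).prod (-ContinuousLinearMap.snd ℝ V V))

/-- The operator `A - z` on the complexified lattice. -/
abbrev complexSub (A : Lattice m V →L[ℝ] Lattice m V) (z : ℂ) :
    Lattice m (V × V) →L[ℝ] Lattice m (V × V) :=
  complexify A - nodewise (complexMul z)

theorem ext_rePart_imPart {x y : Lattice m (V × V)} (h1 : rePart x = rePart y)
    (h2 : imPart x = imPart y) : x = y := by
  ext i : 2
  exact Prod.ext (congrArg (fun u : Lattice m V => u i) h1)
    (congrArg (fun u : Lattice m V => u i) h2)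

theorem rePart_sub_apply (A : Lattice m V →L[ℝ] Lattice m V) (z : ℂ) (x : Lattice m (V × V)) :
    rePart (complexSub A z x) =
      A (rePart x) - z.re • rePart x + z.im • imPart x := by
  ext i
  change A (rePart x) i + 0 - (z.re • (x i).1 - z.im • (x i).2) =
    A (rePart x) i - z.re • (x i).1 + z.im • (x i).2
  abel

theorem imPart_sub_apply (A : Lattice m V →L[ℝ] Lattice m V) (z : ℂ) (x : Lattice m (V × V)) :
    imPart (complexSub A z x) =
      A (imPart x) - z.im • rePart x - z.re • imPart x := by
  ext i
  change 0 + A (imPart x) i - (z.im • (x i).1 + z.re • (x i).2) =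
    A (imPart x) i - z.im • (x i).1 - z.re • (x i).2
  abel

theorem rePart_conjPart (x : Lattice m (V × V)) : rePart (conjPart x) = rePart x := rfl

theorem imPart_conjPart (x : Lattice m (V × V)) : imPart (conjPart x) = -imPart x := rfl

theorem rePart_ofRealPart (x : Lattice m V) : rePart (ofRealPart x) = x := rfl

theorem imPart_ofRealPart (x : Lattice m V) : imPart (ofRealPart x) = 0 := rfl

theorem conjPart_conjPart (x : Lattice m (V × V)) : conjPart (conjPart x) = x :=
  ext_rePart_imPart rfl (by rw [imPart_conjPart, imPart_conjPart, neg_neg])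

/-- Since `A` is real, conjugation intertwines `A - z` with `A - z̄`; an inverse of the former thus
yields one of the latter. -/
theorem conjPart_sub_conjPart (A : Lattice m V →L[ℝ] Lattice m V) (z : ℂ)
    (x : Lattice m (V × V)) :
    conjPart (complexSub A z (conjPart x)) = complexSub A (starRingEnd ℂ z) x := by
  refine ext_rePart_imPart ?_ ?_
  · rw [rePart_conjPart, rePart_sub_apply, rePart_sub_apply, rePart_conjPart, imPart_conjPart,
      Complex.conj_re, Complex.conj_im]
    module
  · rw [imPart_conjPart, imPart_sub_apply, imPart_sub_apply, rePart_conjPart, imPart_conjPart,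
      Complex.conj_re, Complex.conj_im, map_neg]
    module

/-- If `z` is in the `Γ`-resolvent set of `A`, then the real operator `(A - re z)² + (im z)²` is
invertible in the algebra of decaying operators. -/
theorem isUnit_of_mem_resolventGamma (hΓ : IsDecayFunction Γ) (A : decayingSubalgebra Γ V) {z : ℂ}
    (hz : z ∈ resolventGamma Γ (A : Lattice m V →L[ℝ] Lattice m V)) :
    IsUnit ((A - z.re • (1 : decayingSubalgebra Γ V)) ^ 2 +
      (z.im ^ 2) • (1 : decayingSubalgebra Γ V)) := by
  obtain ⟨B, hB, hTB, hBT⟩ := hz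
  set T := complexSub (A : Lattice m V →L[ℝ] Lattice m V) z with hT
  set T' := complexSub (A : Lattice m V →L[ℝ] Lattice m V) (starRingEnd ℂ z) with hT'
  have hconj : ∀ x, conjPart (T (conjPart x)) = T' x := conjPart_sub_conjPart _ z
  have hTB' : ∀ x, T (B x) = x := DFunLike.congr_fun hTB
  have hBT' : ∀ x, B (T x) = x := DFunLike.congr_fun hBT
  set B' := conjPart ∘L B ∘L conjPart with hB'
  have hB'T' : ∀ x, B' (T' x) = x := fun x => by
    rw [← hconj]
    change conjPart (B (conjPart (conjPart _))) = x
    rw [conjPart_conjPart, hBT', conjPart_conjPart]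
  have hT'B' : ∀ x, T' (B' x) = x := fun x => by
    rw [← hconj]
    change conjPart (T (conjPart (conjPart (B (conjPart x))))) = x
    rw [conjPart_conjPart, hTB', conjPart_conjPart]
  set Q : decayingSubalgebra Γ V := (A - z.re • (1 : decayingSubalgebra Γ V)) ^ 2 +
      (z.im ^ 2) • (1 : decayingSubalgebra Γ V) with hQ
  set A' : Lattice m V →L[ℝ] Lattice m V := A.1 with hA'
  have hQapp : ∀ x, (Q : Lattice m V →L[ℝ] Lattice m V) x =
      A' (A' x) - (2 * z.re) • A' x + (z.re ^ 2 + z.im ^ 2) • x := by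
    intro x
    rw [hQ, pow_two]
    change A' (A' x - z.re • x) - z.re • (A' x - z.re • x) + (z.im ^ 2) • x = _
    rw [map_sub, map_smul]
    module
  -- `Q = (A - z̄)(A - z)` has real coefficients, so on the complexified lattice it acts separately
  -- on real and imaginary parts.
  have hre : ∀ x, rePart (T' (T x)) = (Q : Lattice m V →L[ℝ] Lattice m V) (rePart x) := by
    intro x
    rw [hT', rePart_sub_apply, hT, rePart_sub_apply, imPart_sub_apply, hQapp, Complex.conj_re,
      Complex.conj_im]
    simp only [map_sub, map_add, map_smul]
    module
  have hof : ∀ x, T' (T (ofRealPart x)) =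
      ofRealPart ((Q : Lattice m V →L[ℝ] Lattice m V) x) := by
    intro x
    refine ext_rePart_imPart (hre _) ?_
    rw [hT', imPart_sub_apply, hT, rePart_sub_apply, imPart_sub_apply, Complex.conj_re,
      Complex.conj_im, imPart_ofRealPart, imPart_ofRealPart, rePart_ofRealPart]
    simp only [map_sub, map_smul, map_zero]
    module
  have hBdec : IsDecayingLin Γ B := isDecayingLin_of_mem_LGamma hΓ hB
  -- The inverse of `Q` is the restriction of `(A - z)⁻¹ (A - z̄)⁻¹` to real families; it decays as
  -- a composition of decaying maps.
  set C : decayingSubalgebra Γ V := ⟨rePart ∘L (B ∘L B') ∘L ofRealPart,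
    (isDecayingLin_nodewise _).comp ((hBdec.comp ((isDecayingLin_nodewise _).comp
      (hBdec.comp (isDecayingLin_nodewise _)))).comp (isDecayingLin_nodewise _))⟩ with hC
  refine ⟨⟨Q, C, Subtype.ext ?_, Subtype.ext ?_⟩, rfl⟩
  · ext1 x
    change (Q : Lattice m V →L[ℝ] Lattice m V) (rePart (B (B' (ofRealPart x)))) = x
    rw [← hre, hTB', hT'B', rePart_ofRealPart]
  · ext1 x
    change rePart (B (B' (ofRealPart ((Q : Lattice m V →L[ℝ] Lattice m V) x)))) = x
    rw [← hof, hB'T', hBT', rePart_ofRealPart]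

end Resolvent

/-! ### The Banach space `L^n_Γ` and the homological equation. -/

section DecaySpace

set_option linter.unusedSectionVars false

variable {m : ℕ} {V : Type*} [NormedAddCommGroup V] [NormedSpace ℝ V] {Γ : (Fin m → ℤ) → ℝ} {n : ℕ}

theorem IsDecaying.compContinuousLinearMap {ι : Type*} [Fintype ι]
    {T : ContinuousMultilinearMap ℝ (fun _ : ι => Lattice m V) (Lattice m V)}
    (hT : IsDecaying Γ T) (hΓ : IsDecayFunction Γ) {f : ι → Lattice m V →L[ℝ] Lattice m V}
    (hf : ∀ q, IsDecayingLin Γ (f q)) : IsDecaying Γ (T.compContinuousLinearMap f) := by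
  intro R
  choose D hD0 hD using hf
  obtain ⟨C, hC0, hC⟩ := hT ((∑ q, ‖f q‖) * |R|)
  refine ⟨C * ∑ q, D q, mul_nonneg hC0 (Finset.sum_nonneg fun q _ => hD0 q), fun v hv p l c hp => ?_⟩
  have h1 : DecaysAt Γ l ((∑ q, D q) * c) (f p (v p)) :=
    (hD p l c _ hp).mono hΓ (mul_le_mul_of_nonneg_right
      (Finset.single_le_sum (fun q _ => hD0 q) (Finset.mem_univ p)) (hp.nonneg hΓ))
  rw [mul_assoc]
  refine hC (fun q => f q (v q)) (fun q => ?_) p l _ h1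
  refine ((f q).le_opNorm _).trans (mul_le_mul
    (Finset.single_le_sum (fun q _ => norm_nonneg (f q)) (Finset.mem_univ q))
    ((hv q).trans (le_abs_self R)) (norm_nonneg _) (Finset.sum_nonneg fun _ _ => norm_nonneg _))

theorem IsDecaying.compContinuousMultilinearMap {ι : Type*}
    {T : ContinuousMultilinearMap ℝ (fun _ : ι => Lattice m V) (Lattice m V)}
    (hT : IsDecaying Γ T) {S : Lattice m V →L[ℝ] Lattice m V}
    (hS : IsDecayingLin Γ S) : IsDecaying Γ (S.compContinuousMultilinearMap T) := by
  intro R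
  obtain ⟨C, hC0, hC⟩ := hT R
  obtain ⟨D, hD0, hD⟩ := hS
  refine ⟨D * C, mul_nonneg hD0 hC0, fun v hv p l c hp => ?_⟩
  rw [mul_assoc]
  exact hD _ _ _ (hC v hv p l c hp)

theorem IsDecaying.add {ι : Type*}
    {T T' : ContinuousMultilinearMap ℝ (fun _ : ι => Lattice m V) (Lattice m V)}
    (hT : IsDecaying Γ T) (hT' : IsDecaying Γ T') : IsDecaying Γ (T + T') := by
  intro R
  obtain ⟨C, hC0, hC⟩ := hT R
  obtain ⟨D, hD0, hD⟩ := hT' R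
  refine ⟨C + D, add_nonneg hC0 hD0, fun v hv p l c hp => ?_⟩
  rw [add_mul]
  exact (hC v hv p l c hp).add (hD v hv p l c hp)

theorem IsDecaying.smul {ι : Type*}
    {T : ContinuousMultilinearMap ℝ (fun _ : ι => Lattice m V) (Lattice m V)}
    (hT : IsDecaying Γ T) (a : ℝ) : IsDecaying Γ (a • T) := by
  intro R
  obtain ⟨C, hC0, hC⟩ := hT R
  refine ⟨|a| * C, by positivity, fun v hv p l c hp => ?_⟩
  rw [mul_assoc]
  exact (hC v hv p l c hp).smul a

theorem isDecaying_zero {ι : Type*} : IsDecaying Γ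
    (0 : ContinuousMultilinearMap ℝ (fun _ : ι => Lattice m V) (Lattice m V)) := by
  intro R
  refine ⟨0, le_rfl, fun v hv p l c hp k => ?_⟩
  rw [zero_mul, zero_mul]
  exact norm_zero.le

/-- The index set of the supremum that defines `γ(T)`. -/
structure GammaIndex (m : ℕ) (V : Type*) [NormedAddCommGroup V] (n : ℕ) where
  /-- the slot -/
  p : Fin n
  /-- the node at which the value is taken -/
  i : Fin m → ℤ
  /-- the node that supports the argument in the slot `p` -/
  l : Fin m → ℤ
  /-- the arguments -/
  v : Fin n → Lattice m V
  norm_le : ∀ q, ‖v q‖ ≤ 1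
  support : ∀ j, j ≠ l → v p j = 0

/-- The space `L^n_Γ`: the multilinear maps together with the bounded family of values that
enter into `γ`. -/
def decaySubmodule (Γ : (Fin m → ℤ) → ℝ) (V : Type*) [NormedAddCommGroup V] [NormedSpace ℝ V] (n : ℕ) :
    Submodule ℝ (ContinuousMultilinearMap ℝ (fun _ : Fin n => Lattice m V) (Lattice m V) ×
      lp (fun _ : GammaIndex m V n => V) ∞) where
  carrier := {x | ∀ w, x.2 w = (Γ (w.i - w.l))⁻¹ • (x.1 w.v) w.i}
  add_mem' := fun {x y} hx hy w => by
    change x.2 w + y.2 w = (Γ (w.i - w.l))⁻¹ • ((x.1 w.v) w.i + (y.1 w.v) w.i)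
    rw [hx w, hy w, smul_add]
  zero_mem' := fun w => (smul_zero _).symm
  smul_mem' := fun a x hx w => by
    change a • x.2 w = (Γ (w.i - w.l))⁻¹ • a • (x.1 w.v) w.i
    rw [hx w, smul_comm]

/-- The defining relations compare continuous evaluations. The norm inherited from the product is
`‖·‖_Γ`, and closedness makes `L^n_Γ` complete, as Gelfand theory requires. -/
theorem isClosed_decaySubmodule : IsClosed (decaySubmodule Γ V n : Set
    (ContinuousMultilinearMap ℝ (fun _ : Fin n => Lattice m V) (Lattice m V) ×
      lp (fun _ : GammaIndex m V n => V) ∞)) := by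
  change IsClosed {x : ContinuousMultilinearMap ℝ (fun _ : Fin n => Lattice m V) (Lattice m V) ×
      lp (fun _ : GammaIndex m V n => V) ∞ | ∀ w, x.2 w = (Γ (w.i - w.l))⁻¹ • (x.1 w.v) w.i}
  rw [Set.ofPred_forall]
  refine isClosed_iInter fun w => isClosed_eq ?_ ?_
  · exact (lp.evalCLM ℝ (fun _ : GammaIndex m V n => V) ∞ w).continuous.comp continuous_snd
  · refine Continuous.const_smul ?_ _
    exact (lp.evalCLM ℝ (fun _ : Fin m → ℤ => V) ∞ w.i).continuous.comp
      ((ContinuousMultilinearMap.apply ℝ (fun _ : Fin n => Lattice m V) (Lattice m V)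
        w.v).continuous.comp continuous_fst)

/-- The Banach space `L^n_Γ`, as a type. -/
def DecaySpace (Γ : (Fin m → ℤ) → ℝ) (V : Type*) [NormedAddCommGroup V] [NormedSpace ℝ V]
    (n : ℕ) : Type _ :=
  decaySubmodule Γ V n

instance : NormedAddCommGroup (DecaySpace Γ V n) :=
  inferInstanceAs (NormedAddCommGroup (decaySubmodule Γ V n))

instance : NormedSpace ℝ (DecaySpace Γ V n) :=
  inferInstanceAs (NormedSpace ℝ (decaySubmodule Γ V n))

instance [CompleteSpace V] : CompleteSpace (DecaySpace Γ V n) :=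
  isClosed_decaySubmodule.completeSpace_coe

/-- The multilinear map underlying an element of `L^n_Γ`. -/
def DecaySpace.toMultilinear : DecaySpace Γ V n →L[ℝ]
    ContinuousMultilinearMap ℝ (fun _ : Fin n => Lattice m V) (Lattice m V) :=
  (ContinuousLinearMap.fst ℝ _ _ ∘L (decaySubmodule Γ V n).subtypeL :
    decaySubmodule Γ V n →L[ℝ] _)

theorem DecaySpace.toMultilinear_injective :
    Function.Injective (DecaySpace.toMultilinear (Γ := Γ) (V := V) (n := n)) := by
  intro x y h
  have h1 : x.1.1 = y.1.1 := h
  refine Subtype.ext (Prod.ext h1 ?_)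
  ext w
  rw [x.2 w, y.2 w, h1]

theorem DecaySpace.isDecaying (hΓ : IsDecayFunction Γ) (x : DecaySpace Γ V n) :
    IsDecaying Γ (DecaySpace.toMultilinear x) := by
  refine isDecaying_of_mem_LGammaMulti hΓ (max_lt enorm_lt_top ?_)
  refine lt_of_le_of_lt (b := ENNReal.ofReal ‖x.1.2‖) ?_ ENNReal.ofReal_lt_top
  refine iSup_le fun p => iSup_le fun i => iSup_le fun l => iSup_le fun v => iSup_le fun hv =>
      iSup_le fun hl => enorm_div_le (hΓ.pos _) ?_
  have h1 := x.2 ⟨p, i, l, v, hv, hl⟩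
  have h2 := lp.norm_apply_le_norm ENNReal.top_ne_zero x.1.2 ⟨p, i, l, v, hv, hl⟩
  rw [h1, norm_smul, norm_inv, Real.norm_of_nonneg (hΓ.pos _).le, inv_mul_le_iff₀ (hΓ.pos _),
    mul_comm] at h2
  exact h2

theorem DecaySpace.exists_of_isDecaying (hΓ : IsDecayFunction Γ)
    {T : ContinuousMultilinearMap ℝ (fun _ : Fin n => Lattice m V) (Lattice m V)}
    (hT : IsDecaying Γ T) : ∃ x : DecaySpace Γ V n, DecaySpace.toMultilinear x = T := by
  obtain ⟨C, hC, h⟩ := hT 1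
  refine ⟨⟨(T, ⟨fun w => (Γ (w.i - w.l))⁻¹ • (T w.v) w.i, memℓp_infty ⟨C * (Γ 0)⁻¹, ?_⟩⟩),
    fun w => rfl⟩, rfl⟩
  rintro _ ⟨w, rfl⟩
  have := h w.v w.norm_le w.p w.l _ (DecaysAt.of_support hΓ (w.norm_le w.p) w.support) w.i
  dsimp only
  rwa [norm_smul, norm_inv, Real.norm_of_nonneg (hΓ.pos _).le, inv_mul_le_iff₀ (hΓ.pos _), mul_comm]

/-- An operator on multilinear maps that preserves decay acts continuously on `L^n_Γ`. -/
theorem DecaySpace.exists_lift [CompleteSpace V] (hΓ : IsDecayFunction Γ)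
    (L : ContinuousMultilinearMap ℝ (fun _ : Fin n => Lattice m V) (Lattice m V) →L[ℝ]
      ContinuousMultilinearMap ℝ (fun _ : Fin n => Lattice m V) (Lattice m V))
    (hL : ∀ T, IsDecaying Γ T → IsDecaying Γ (L T)) :
    ∃ f : DecaySpace Γ V n →L[ℝ] DecaySpace Γ V n,
      ∀ x, DecaySpace.toMultilinear (f x) = L (DecaySpace.toMultilinear x) := by
  choose f hf using fun x : DecaySpace Γ V n =>
    exists_of_isDecaying hΓ (hL _ (DecaySpace.isDecaying hΓ x))
  set g : DecaySpace Γ V n →ₗ[ℝ] DecaySpace Γ V n :=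
    { toFun := f
      map_add' := fun x y => toMultilinear_injective (by simp only [hf, map_add])
      map_smul' := fun a x => toMultilinear_injective (by
        simp only [hf, map_smul, RingHom.id_apply]) }
  -- The closed graph theorem spares an estimate in `‖·‖_Γ`: limits are identified in the operator
  -- norm, where `L` is continuous, and `toMultilinear` is injective.
  have hcont : Continuous g := by
    refine LinearMap.continuous_of_seq_closed_graph (𝕜 := ℝ) (E := DecaySpace Γ V n)
      (F := DecaySpace Γ V n) (g := g) fun u x y hu hgu => toMultilinear_injective ?_
    have h1 : Tendsto (fun k => toMultilinear (g (u k))) atTop (𝓝 (toMultilinear y)) :=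
      (toMultilinear.continuous.tendsto y).comp hgu
    have h2 : Tendsto (fun k => L (toMultilinear (u k))) atTop (𝓝 (L (toMultilinear x))) :=
      ((L.continuous.comp toMultilinear.continuous).tendsto x).comp hu
    have h3 : (fun k => toMultilinear (g (u k))) = fun k => L (toMultilinear (u k)) :=
      funext fun k => hf _
    rw [h3] at h1
    exact (tendsto_nhds_unique h1 h2).trans (hf x).symm
  exact ⟨⟨g, hcont⟩, hf⟩

theorem DecaySpace.clm_ext {f g : DecaySpace Γ V n →L[ℝ] DecaySpace Γ V n}
    (h : ∀ x v, DecaySpace.toMultilinear (f x) v = DecaySpace.toMultilinear (g x) v) : f = g :=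
  ContinuousLinearMap.ext fun x => DecaySpace.toMultilinear_injective
    (ContinuousMultilinearMap.ext (h x))

/-- Decaying operators act on `L^n_Γ` by composition on the left. -/
theorem DecaySpace.exists_left [CompleteSpace V] (hΓ : IsDecayFunction Γ) :
    ∃ f : decayingSubalgebra Γ V →ₐ[ℝ] (DecaySpace Γ V n →L[ℝ] DecaySpace Γ V n),
      ∀ S x v, DecaySpace.toMultilinear (f S x) v =
        (S : Lattice m V →L[ℝ] Lattice m V) (DecaySpace.toMultilinear x v) := by
  choose f hf using fun S : decayingSubalgebra Γ V =>
    exists_lift (n := n) hΓ (ContinuousLinearMap.compContinuousMultilinearMapL ℝ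
      (fun _ : Fin n => Lattice m V) (Lattice m V) (Lattice m V)
        (S : Lattice m V →L[ℝ] Lattice m V)) fun T hT => hT.compContinuousMultilinearMap S.2
  have hf' : ∀ S x v, toMultilinear (f S x) v =
      (S : Lattice m V →L[ℝ] Lattice m V) (toMultilinear x v) := fun S x v =>
    congrArg (fun T => T v) (hf S x)
  refine ⟨AlgHom.ofLinearMap
    { toFun := f
      map_add' := fun S S' => clm_ext fun x v => ?_
      map_smul' := fun a S => clm_ext fun x v => ?_ } (clm_ext fun x v => ?_)
      fun S S' => clm_ext fun x v => ?_, hf'⟩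
  · rw [hf']
    change _ = toMultilinear (f S x + f S' x) v
    rw [map_add]
    change _ = toMultilinear (f S x) v + toMultilinear (f S' x) v
    rw [hf', hf']
    rfl
  · rw [hf']
    change _ = toMultilinear (a • f S x) v
    rw [map_smul]
    change _ = a • toMultilinear (f S x) v
    rw [hf']
    rfl
  · exact hf' _ _ _
  · change toMultilinear (f (S * S') x) v = toMultilinear (f S (f S' x)) v
    rw [hf', hf', hf']
    rfl

/-- Decaying operators act on `L^n_Γ` by composition in the slot `p`. -/
theorem DecaySpace.exists_right [CompleteSpace V] (hΓ : IsDecayFunction Γ) (p : Fin n) :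
    ∃ f : decayingSubalgebra Γ V →ₐ[ℝ] (DecaySpace Γ V n →L[ℝ] DecaySpace Γ V n)ᵐᵒᵖ,
      ∀ S x v, DecaySpace.toMultilinear ((f S).unop x) v = DecaySpace.toMultilinear x
        (Function.update v p ((S : Lattice m V →L[ℝ] Lattice m V) (v p))) := by
  choose f hf using fun S : decayingSubalgebra Γ V =>
    exists_lift (n := n) hΓ (ContinuousMultilinearMap.compContinuousLinearMapL
      (Function.update (fun _ : Fin n => ContinuousLinearMap.id ℝ (Lattice m V)) p
        (S : Lattice m V →L[ℝ] Lattice m V))) fun T hT => hT.compContinuousLinearMap hΓ fun q => by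
          rcases eq_or_ne q p with rfl | hq
          · rw [Function.update_self]
            exact S.2
          · rw [Function.update_of_ne hq]
            exact isDecayingLin_id
  have hf' : ∀ S x v, toMultilinear (f S x) v = toMultilinear x
      (Function.update v p ((S : Lattice m V →L[ℝ] Lattice m V) (v p))) := fun S x v => by
    refine (congrArg (fun T => T v) (hf S x)).trans ?_
    refine congrArg (toMultilinear x) (funext fun q => ?_)
    change (Function.update (fun _ : Fin n => ContinuousLinearMap.id ℝ (Lattice m V)) p S.1 q)
      (v q) = _
    rcases eq_or_ne q p with rfl | hq
    · rw [Function.update_self, Function.update_self]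
    · rw [Function.update_of_ne hq, Function.update_of_ne hq]
      rfl
  refine ⟨AlgHom.ofLinearMap
    { toFun := fun S => MulOpposite.op (f S)
      map_add' := fun S S' => MulOpposite.unop_injective (clm_ext fun x v => ?_)
      map_smul' := fun a S => MulOpposite.unop_injective (clm_ext fun x v => ?_) }
      (MulOpposite.unop_injective (clm_ext fun x v => ?_))
      fun S S' => MulOpposite.unop_injective (clm_ext fun x v => ?_), hf'⟩
  · change toMultilinear (f (S + S') x) v = toMultilinear (f S x + f S' x) v
    rw [hf', map_add]
    change _ = toMultilinear (f S x) v + toMultilinear (f S' x) v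
    rw [hf', hf', ← ContinuousMultilinearMap.map_update_add]
    rfl
  · change toMultilinear (f (a • S) x) v = toMultilinear (a • f S x) v
    rw [hf', map_smul]
    change _ = a • toMultilinear (f S x) v
    rw [hf', ← ContinuousMultilinearMap.map_update_smul]
    rfl
  · change toMultilinear (f 1 x) v = toMultilinear x v
    rw [hf']
    exact congrArg (toMultilinear x) (Function.update_eq_self _ _)
  -- Composition on the right reverses products, hence the opposite algebra.
  · change toMultilinear (f (S * S') x) v = toMultilinear (f S' (f S x)) v
    rw [hf', hf', hf', Function.update_idem, Function.update_self]
    rfl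

/-- Solution of the homological equation `A T - T (A, …, A) = G` for decaying multilinear maps at a
nonresonant order. -/
theorem exists_sylvester [CompleteSpace V] (hΓ : IsDecayFunction Γ)
    {A : Lattice m V →L[ℝ] Lattice m V} (hA : IsDecayingLin Γ A)
    (hn : specGamma Γ A ^ n ∩ specGamma Γ A = ∅)
    {G : ContinuousMultilinearMap ℝ (fun _ : Fin n => Lattice m V) (Lattice m V)}
    (hG : IsDecaying Γ G) :
    ∃ T : ContinuousMultilinearMap ℝ (fun _ : Fin n => Lattice m V) (Lattice m V),
      IsDecaying Γ T ∧ ∀ v, A (T v) - T (fun q => A (v q)) = G v := by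
  set A' : decayingSubalgebra Γ V := ⟨A, hA⟩
  obtain ⟨lam, hlam⟩ := DecaySpace.exists_left (n := n) (V := V) hΓ
  choose rho hrho using fun p => DecaySpace.exists_right (n := n) (V := V) hΓ p
  obtain ⟨G', hG'⟩ := DecaySpace.exists_of_isDecaying hΓ hG
  have hunit : ∀ z ∉ specGamma Γ A, IsUnit ((A' - z.re • (1 : decayingSubalgebra Γ V)) ^ 2 +
      (z.im ^ 2) • (1 : decayingSubalgebra Γ V)) := fun z hz =>
    isUnit_of_mem_resolventGamma hΓ A' (not_not.1 hz)
  have hcomm : ∀ p, lam A' * (rho p A').unop = (rho p A').unop * lam A' := fun p =>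
    DecaySpace.clm_ext fun x v => by
      change DecaySpace.toMultilinear (lam A' ((rho p A').unop x)) v =
        DecaySpace.toMultilinear ((rho p A').unop (lam A' x)) v
      rw [hlam, hrho, hrho, hlam]
  have hcomm' : ∀ p q, (rho p A').unop * (rho q A').unop = (rho q A').unop * (rho p A').unop :=
    fun p q => DecaySpace.clm_ext fun x v => by
      change DecaySpace.toMultilinear ((rho p A').unop ((rho q A').unop x)) v =
        DecaySpace.toMultilinear ((rho q A').unop ((rho p A').unop x)) v
      rw [hrho, hrho, hrho, hrho]
      rcases eq_or_ne p q with rfl | hpq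
      · rfl
      · rw [Function.update_of_ne hpq.symm, Function.update_of_ne hpq,
          Function.update_comm hpq.symm]
  -- The units supplied by the resolvent are carried by the homomorphisms `lam` and `rho p` to units
  -- acting on `L^n_Γ`; this is the spectral inclusion needed.
  have hsurj := surjective_sub_prod hn
    (lam A') (fun p => (rho p A').unop) hcomm hcomm'
    (fun z hz => by
      have := (hunit z hz).map lam
      rwa [map_add, map_pow, map_sub, map_smul, map_smul, map_one] at this)
    (fun p z hz => by
      have := ((hunit z hz).map (rho p)).unop
      rwa [map_add, map_pow, map_sub, map_smul, map_smul, map_one, MulOpposite.unop_add,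
        MulOpposite.unop_pow, MulOpposite.unop_sub, MulOpposite.unop_smul, MulOpposite.unop_smul,
        MulOpposite.unop_one] at this)
  obtain ⟨x, hx⟩ := hsurj G'
  refine ⟨DecaySpace.toMultilinear x, DecaySpace.isDecaying hΓ x, fun v => ?_⟩
  -- Distinct slots ensure that `A` is inserted only once in each; over all slots this gives `T (A,
  -- …, A)`.
  have hprod : ∀ L : List (Fin n), L.Nodup → ∀ v,
      DecaySpace.toMultilinear ((L.map fun p => (rho p A').unop).prod x) v =
        DecaySpace.toMultilinear x (fun q => if q ∈ L then A (v q) else v q) := by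
    intro L
    induction L with
    | nil =>
      intro _ v
      simp
    | cons p L ih =>
      intro hL v
      rw [List.nodup_cons] at hL
      rw [List.map_cons, List.prod_cons]
      change DecaySpace.toMultilinear ((rho p A').unop
        ((L.map fun p => (rho p A').unop).prod x)) v = _
      rw [hrho, ih hL.2]
      refine congrArg (DecaySpace.toMultilinear x) ?_
      funext q
      rcases eq_or_ne q p with rfl | hq
      · simp [hL.1, A']
      · simp [hq]
  have h1 := hprod (List.finRange n) (List.nodup_finRange n) v
  rw [← List.ofFn_eq_map] at h1
  have h2 : DecaySpace.toMultilinear (lam A' x - (List.ofFn fun p => (rho p A').unop).prod x) v =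
      G v := by
    rw [← hG', ← hx]
    rfl
  rw [map_sub] at h2
  change DecaySpace.toMultilinear (lam A' x) v -
    DecaySpace.toMultilinear ((List.ofFn fun p => (rho p A').unop).prod x) v = G v at h2
  rw [h1, hlam] at h2
  simpa [A'] using h2

end DecaySpace

/-! ### Taylor's formula with Peano remainder. -/

section Taylor

universe u

/-- Taylor's theorem with Peano remainder at the origin of a normed space. -/
theorem taylor_isLittleO_norm_pow {E : Type u} [NormedAddCommGroup E] [NormedSpace ℝ E] (n : ℕ) :
    ∀ {G : Type u} [NormedAddCommGroup G] [NormedSpace ℝ G] {f : E → G}, ContDiffAt ℝ n f 0 →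
      (fun x => f x - ∑ k ∈ Finset.range (n + 1),
        ((k.factorial : ℝ)⁻¹) • iteratedFDeriv ℝ k f 0 (fun _ => x)) =o[𝓝 0]
          fun x => ‖x‖ ^ n := by
  induction n with
  | zero =>
    intro G _ _ f hf
    simp only [zero_add, Finset.range_one, Finset.sum_singleton, Nat.factorial_zero, Nat.cast_one,
      inv_one, one_smul, iteratedFDeriv_zero_apply, pow_zero]
    rw [isLittleO_one_iff]
    simpa using hf.continuousAt.tendsto.sub_const (f 0)
  | succ n ih =>
    intro G _ _ f hf
    -- The induction passes to the derivative, whose values lie in `E →L[ℝ] G`; this is why `G` is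
    -- quantified inside the induction and shares the universe of `E`.
    have hf' : ContDiffAt ℝ n (fderiv ℝ f) 0 := hf.fderiv_right (by norm_cast)
    have h1 := ih hf'
    rw [isLittleO_iff] at h1 ⊢
    intro ε hε
    have h2 : ∀ᶠ y in 𝓝 (0 : E), DifferentiableAt ℝ f y := by
      have h3 : ContDiffAt ℝ 1 f 0 := hf.of_le (by exact_mod_cast Nat.succ_pos n)
      filter_upwards [h3.eventually (by simp)] with y hy
      exact hy.differentiableAt (by simp)
    obtain ⟨δ, hδ, hball⟩ := Metric.eventually_nhds_iff_ball.1 ((h1 hε).and h2)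
    filter_upwards [Metric.ball_mem_nhds 0 hδ] with x hx
    -- Along the segment from `0` to `x`, the derivative of the remainder of `f` is the remainder of
    -- `fderiv ℝ f` applied to `x`. This supplies the additional factor `‖x‖`, and the mean value
    -- inequality concludes.
    set φ : ℝ → G := fun t => f (t • x) - ∑ k ∈ Finset.range (n + 2),
      t ^ k • ((k.factorial : ℝ)⁻¹) • iteratedFDeriv ℝ k f 0 (fun _ => x) with hφ
    set φ' : ℝ → G := fun t => (fderiv ℝ f (t • x) - ∑ k ∈ Finset.range (n + 1),
      ((k.factorial : ℝ)⁻¹) • iteratedFDeriv ℝ k (fderiv ℝ f) 0 (fun _ => t • x)) x with hφ'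
    have hmem : ∀ t ∈ Icc (0 : ℝ) 1, t • x ∈ Metric.ball (0 : E) δ := fun t ht => by
      rw [mem_ball_zero_iff] at hx ⊢
      rw [norm_smul, Real.norm_of_nonneg ht.1]
      exact (mul_le_of_le_one_left (norm_nonneg _) ht.2).trans_lt hx
    have hder : ∀ t ∈ Icc (0 : ℝ) 1, HasDerivAt φ (φ' t) t := by
      intro t ht
      have e1 : HasDerivAt (fun t : ℝ => f (t • x)) (fderiv ℝ f (t • x) x) t := by
        have e2 : HasDerivAt (fun t : ℝ => t • x) x t := by
          simpa using (hasDerivAt_id t).smul_const x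
        exact (hball _ (hmem t ht)).2.hasFDerivAt.comp_hasDerivAt t e2
      have e3 : HasDerivAt (fun t : ℝ => ∑ k ∈ Finset.range (n + 2),
          t ^ k • ((k.factorial : ℝ)⁻¹) • iteratedFDeriv ℝ k f 0 (fun _ => x))
          (∑ k ∈ Finset.range (n + 2), ((k : ℝ) * t ^ (k - 1)) •
            ((k.factorial : ℝ)⁻¹) • iteratedFDeriv ℝ k f 0 (fun _ => x)) t :=
        HasDerivAt.fun_sum fun k _ => (hasDerivAt_pow k t).smul_const _
      have e4 := e1.sub e3
      have e5 : ∑ k ∈ Finset.range (n + 2), ((k : ℝ) * t ^ (k - 1)) •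
            ((k.factorial : ℝ)⁻¹) • iteratedFDeriv ℝ k f 0 (fun _ => x) =
          (∑ k ∈ Finset.range (n + 1), ((k.factorial : ℝ)⁻¹) •
            iteratedFDeriv ℝ k (fderiv ℝ f) 0 (fun _ => t • x)) x := by
        rw [Finset.sum_range_succ', Nat.cast_zero, zero_mul, zero_smul, add_zero,
          sum_apply]
        refine Finset.sum_congr rfl fun k _ => ?_
        have e6 : iteratedFDeriv ℝ k (fderiv ℝ f) 0 (fun _ => t • x) =
            t ^ k • iteratedFDeriv ℝ k (fderiv ℝ f) 0 (fun _ => x) := by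
          rw [(iteratedFDeriv ℝ k (fderiv ℝ f) 0).map_smul_univ (fun _ => t) fun _ => x]
          simp
        have e7 : iteratedFDeriv ℝ (k + 1) f 0 (fun _ => x) =
            iteratedFDeriv ℝ k (fderiv ℝ f) 0 (fun _ => x) x := by
          rw [iteratedFDeriv_succ_apply_right]
          rfl
        rw [e6, e7, smul_apply, smul_apply, smul_smul,
          smul_smul, Nat.factorial_succ, Nat.add_sub_cancel]
        congr 1
        have : (k.factorial : ℝ) ≠ 0 := by positivity
        have : ((k + 1 : ℕ) : ℝ) ≠ 0 := by positivity
        push_cast at *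
        field_simp
      have e8 : φ' t = fderiv ℝ f (t • x) x - (∑ k ∈ Finset.range (n + 1), ((k.factorial : ℝ)⁻¹) •
          iteratedFDeriv ℝ k (fderiv ℝ f) 0 (fun _ => t • x)) x := rfl
      rw [e8, ← e5]
      exact e4
    have hbound : ∀ t ∈ Ico (0 : ℝ) 1, ‖φ' t‖ ≤ ε * ‖x‖ ^ (n + 1) := by
      intro t ht
      have e1 := (hball _ (hmem t ⟨ht.1, ht.2.le⟩)).1
      refine (ContinuousLinearMap.le_opNorm _ _).trans ?_
      rw [pow_succ, ← mul_assoc]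
      refine mul_le_mul_of_nonneg_right (e1.trans ?_) (norm_nonneg _)
      rw [norm_pow, norm_norm, norm_smul, Real.norm_of_nonneg ht.1]
      have e2 : (t * ‖x‖) ^ n ≤ ‖x‖ ^ n :=
        pow_le_pow_left₀ (mul_nonneg ht.1 (norm_nonneg _))
          (mul_le_of_le_one_left (norm_nonneg _) ht.2.le) n
      exact mul_le_mul_of_nonneg_left e2 hε.le
    have hmv := norm_image_sub_le_of_norm_deriv_le_segment_01'
      (fun t ht => (hder t ht).hasDerivWithinAt) hbound
    have h0 : φ 0 = 0 := by
      rw [hφ]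
      simp [Finset.sum_range_succ']
    have h1 : φ 1 = f x - ∑ k ∈ Finset.range (n + 1 + 1),
        ((k.factorial : ℝ)⁻¹) • iteratedFDeriv ℝ k f 0 (fun _ => x) := by
      simp [hφ]
    rw [h0, sub_zero, h1] at hmv
    rw [norm_pow, norm_norm]
    exact hmv

end Taylor

/-! ### Derivatives of decaying polynomials. -/

section Polynomial

set_option linter.unusedSectionVars false

variable {m : ℕ} {V : Type*} [NormedAddCommGroup V] [NormedSpace ℝ V] {Γ : (Fin m → ℤ) → ℝ} {n : ℕ}

open Classical in
-- Differentiating `k` times places the `k` directions injectively into the `n` slots and leaves `x`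
-- in the others; for `k > n` the sum is empty.
theorem iteratedFDeriv_diagonal_apply {E G : Type*} [NormedAddCommGroup E] [NormedSpace ℝ E]
    [NormedAddCommGroup G] [NormedSpace ℝ G]
    (T : ContinuousMultilinearMap ℝ (fun _ : Fin n => E) G) (k : ℕ) (x : E) (v : Fin k → E) :
    iteratedFDeriv ℝ k (fun x => T fun _ => x) x v = ∑ e : Fin k ↪ Fin n,
      T fun j => if h : j ∈ Set.range e then v (e.toEquivRange.symm ⟨j, h⟩) else x := by
  let g : E →L[ℝ] (Fin n → E) := ContinuousLinearMap.pi fun _ => ContinuousLinearMap.id ℝ E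
  change iteratedFDeriv ℝ k (T ∘ g) x v = _
  rw [ContinuousLinearMap.iteratedFDeriv_comp_right _ T.contDiff _ le_rfl, T.iteratedFDeriv_eq]
  simp only [ContinuousMultilinearMap.iteratedFDeriv,
    ContinuousMultilinearMap.compContinuousLinearMap_apply, sum_apply,
    ContinuousMultilinearMap.iteratedFDerivComponent_apply, Pi.compRightL_apply]
  refine Finset.sum_congr rfl fun e _ => congrArg T (funext fun j => ?_)
  by_cases h : j ∈ Set.range e
  · obtain ⟨i, rfl⟩ := h
    rw [dif_pos (mem_range_self i), dif_pos (mem_range_self i)]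
    change v _ = v _
    exact congrArg v (((Equiv.symm_apply_eq _).2 rfl).trans ((Equiv.symm_apply_eq _).2 rfl).symm)
  · rw [dif_neg h, dif_neg h]
    rfl

theorem contDiff_diagonal {E G : Type*} [NormedAddCommGroup E] [NormedSpace ℝ E]
    [NormedAddCommGroup G] [NormedSpace ℝ G]
    (T : ContinuousMultilinearMap ℝ (fun _ : Fin n => E) G) {k : WithTop ℕ∞} :
    ContDiff ℝ k fun x => T fun _ => x :=
  T.contDiff.comp (contDiff_pi.2 fun _ => contDiff_id)

theorem DecaysAt.sum {α : Type*} {s : Finset α} {l : Fin m → ℤ} {c : α → ℝ} {x : α → Lattice m V}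
    (h : ∀ a ∈ s, DecaysAt Γ l (c a) (x a)) : DecaysAt Γ l (∑ a ∈ s, c a) (∑ a ∈ s, x a) := by
  classical
  induction s using Finset.induction_on with
  | empty =>
    intro k
    rw [Finset.sum_empty, Finset.sum_empty, zero_mul]
    exact norm_zero.le
  | insert a s ha ih =>
    rw [Finset.sum_insert ha, Finset.sum_insert ha]
    exact (h a (Finset.mem_insert_self a s)).add
      (ih fun b hb => h b (Finset.mem_insert_of_mem hb))

theorem norm_apply_le_of_forall_le
    {T : ContinuousMultilinearMap ℝ (fun _ : Fin n => Lattice m V) (Lattice m V)}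
    {v : Fin n → Lattice m V} {R : ℝ} (hv : ∀ q, ‖v q‖ ≤ R) : ‖T v‖ ≤ ‖T‖ * R ^ n := by
  refine (T.le_opNorm v).trans (mul_le_mul_of_nonneg_left ?_ (norm_nonneg _))
  refine (Finset.prod_le_prod (fun _ _ => norm_nonneg _) fun q _ => hv q).trans (le_of_eq ?_)
  simp

/-- In each summand the direction `v p` occupies the slot `e p` of `T`, so its decay is inherited;
`B` is a uniform bound per summand times the number of embeddings. -/
theorem IsDecaying.exists_bound_iteratedFDeriv (hΓ : IsDecayFunction Γ)
    {T : ContinuousMultilinearMap ℝ (fun _ : Fin n => Lattice m V) (Lattice m V)}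
    (hT : IsDecaying Γ T) (k : ℕ) (R : ℝ) :
    ∃ B : ℝ, 0 ≤ B ∧ ∀ x : Lattice m V, ‖x‖ ≤ R → ∀ v : Fin k → Lattice m V, (∀ q, ‖v q‖ ≤ 1) →
      ‖iteratedFDeriv ℝ k (fun x => T fun _ => x) x v‖ ≤ B ∧ ∀ p l c, DecaysAt Γ l c (v p) →
        DecaysAt Γ l (B * c) (iteratedFDeriv ℝ k (fun x => T fun _ => x) x v) := by
  classical
  obtain ⟨C, hC0, hC⟩ := hT (max R 1)
  have hD0 : 0 ≤ ‖T‖ * max R 1 ^ n := by positivity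
  refine ⟨∑ _e : Fin k ↪ Fin n, (C + ‖T‖ * max R 1 ^ n),
    Finset.sum_nonneg fun _ _ => add_nonneg hC0 hD0, fun x hx v hv => ?_⟩
  have hw : ∀ (e : Fin k ↪ Fin n) (q : Fin n), ‖(if h : q ∈ Set.range e then
      v (e.toEquivRange.symm ⟨q, h⟩) else x : Lattice m V)‖ ≤ max R 1 := by
    intro e q
    split_ifs
    · exact (hv _).trans (le_max_right _ _)
    · exact hx.trans (le_max_left _ _)
  rw [iteratedFDeriv_diagonal_apply]
  refine ⟨norm_sum_le_of_le _ fun e _ => ?_, fun p l c hp => ?_⟩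
  · exact (norm_apply_le_of_forall_le (hw e)).trans (le_add_of_nonneg_left hC0)
  · rw [Finset.sum_mul]
    refine DecaysAt.sum fun e _ => ?_
    refine (hC _ (hw e) (e p) l c ?_).mono hΓ
      (mul_le_mul_of_nonneg_right (le_add_of_nonneg_right hD0) (hp.nonneg hΓ))
    rw [dif_pos (mem_range_self p)]
    rw [Function.Embedding.toEquivRange_symm_apply_self]
    exact hp

/-- Polynomials with decay are smooth with decaying derivatives on bounded sets. -/
theorem IsGammaPolynomial.isCInftyGamma (hΓ : IsDecayFunction Γ) {r : ℕ}
    {F : Lattice m V → Lattice m V} (hF : IsGammaPolynomial Γ r F) : IsCInftyGamma Γ F := by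
  obtain ⟨c, hc, hcF⟩ := hF
  obtain rfl : F = fun x => ∑ j ∈ Finset.range (r + 1), c j (fun _ => x) := funext hcF
  intro U _ hU k
  obtain ⟨R, hR⟩ := hU.exists_norm_le
  refine ⟨(ContDiff.sum fun j _ => contDiff_diagonal (c j)).contDiffOn, ?_, fun k _ _ => ?_⟩
  · refine lt_of_le_of_lt (b := ENNReal.ofReal (∑ j ∈ Finset.range (r + 1), ‖c j‖ * R ^ j))
      (iSup₂_le fun x hx => ?_) ENNReal.ofReal_lt_top
    rw [← ofReal_norm]
    exact ENNReal.ofReal_le_ofReal (norm_sum_le_of_le _ fun j _ =>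
      norm_apply_le_of_forall_le fun _ => hR x hx)
  · choose B hB0 hB using fun j =>
      (isDecaying_of_mem_LGammaMulti hΓ (hc j)).exists_bound_iteratedFDeriv hΓ k R
    have hsum : ∀ x v, iteratedFDeriv ℝ k (fun x => ∑ j ∈ Finset.range (r + 1), c j fun _ => x) x v =
        ∑ j ∈ Finset.range (r + 1), iteratedFDeriv ℝ k (fun x => c j fun _ => x) x v := by
      intro x v
      rw [iteratedFDeriv_sum fun j _ => contDiff_diagonal (c j), Finset.sum_apply,
        sum_apply]
    have hle : ∀ x ∈ U, normGammaMulti Γ (iteratedFDeriv ℝ k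
        (fun x => ∑ j ∈ Finset.range (r + 1), c j fun _ => x) x) ≤ ENNReal.ofReal
          (max (∑ j ∈ Finset.range (r + 1), B j) ((∑ j ∈ Finset.range (r + 1), B j) * (Γ 0)⁻¹)) := by
      intro x hx
      refine normGammaMulti_le hΓ (Finset.sum_nonneg fun j _ => hB0 j) (fun v hv => ?_)
        fun v hv p l c' hp => ?_
      · rw [hsum]
        exact norm_sum_le_of_le _ fun j _ => (hB j x (hR x hx) v hv).1
      · rw [hsum, Finset.sum_mul]
        exact DecaysAt.sum fun j _ => (hB j x (hR x hx) v hv).2 p l c' hp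
    exact ⟨fun x hx => (hle x hx).trans_lt ENNReal.ofReal_lt_top,
      (iSup₂_le hle).trans_lt ENNReal.ofReal_lt_top⟩

end Polynomial

/-! ### Algebra of decaying polynomials graded by order of vanishing. -/

section Order

set_option linter.unusedSectionVars false

variable {m : ℕ} {V : Type*} [NormedAddCommGroup V] [NormedSpace ℝ V] {Γ : (Fin m → ℤ) → ℝ} {n : ℕ}

/-- Composition of a multilinear map with multilinear maps in disjoint sets of variables. -/
def compMultilinear {E : Type*} [NormedAddCommGroup E] [NormedSpace ℝ E] {ι : Type*} {κ : ι → Type*}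
    (T : ContinuousMultilinearMap ℝ (fun _ : ι => E) E)
    (S : ∀ i, ContinuousMultilinearMap ℝ (fun _ : κ i => E) E) :
    ContinuousMultilinearMap ℝ (fun _ : (Σ i, κ i) => E) E where
  toMultilinearMap := T.toMultilinearMap.compMultilinearMap fun i => (S i).toMultilinearMap
  cont := T.cont.comp (continuous_pi fun i => (S i).cont.comp
    (continuous_pi fun j => continuous_apply (⟨i, j⟩ : Σ i, κ i)))

/-- The argument with index `⟨p, q⟩` enters only through `S p`; its decay passes through `S p` and
then through the slot `p` of `T`. -/
theorem IsDecaying.compMultilinear (hΓ : IsDecayFunction Γ) {ι : Type*} [Fintype ι] {κ : ι → Type*}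
    [∀ i, Fintype (κ i)] {T : ContinuousMultilinearMap ℝ (fun _ : ι => Lattice m V) (Lattice m V)}
    {S : ∀ i, ContinuousMultilinearMap ℝ (fun _ : κ i => Lattice m V) (Lattice m V)}
    (hT : IsDecaying Γ T) (hS : ∀ i, IsDecaying Γ (S i)) :
    IsDecaying Γ (LatticeDecay.compMultilinear T S) := by
  intro R
  choose D hD0 hD using fun i => hS i R
  have hb0 : ∀ i, 0 ≤ ‖S i‖ * |R| ^ Fintype.card (κ i) := fun i => by positivity
  obtain ⟨C, hC0, hC⟩ := hT (∑ i, ‖S i‖ * |R| ^ Fintype.card (κ i))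
  refine ⟨C * ∑ i, D i, mul_nonneg hC0 (Finset.sum_nonneg fun i _ => hD0 i), ?_⟩
  rintro v hv ⟨p, q⟩ l c hp
  rw [mul_assoc]
  refine hC (fun i => S i fun j => v ⟨i, j⟩) (fun i => ?_) p l _ ?_
  · refine le_trans ?_ (Finset.single_le_sum (fun i _ => hb0 i) (Finset.mem_univ i))
    refine ((S i).le_opNorm _).trans (mul_le_mul_of_nonneg_left ?_ (norm_nonneg _))
    refine (Finset.prod_le_prod (fun _ _ => norm_nonneg _)
      fun j _ => (hv ⟨i, j⟩).trans (le_abs_self R)).trans (le_of_eq ?_)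
    rw [Finset.prod_const, Finset.card_univ]
  · exact (hD p _ (fun j => hv ⟨p, j⟩) q l c hp).mono hΓ (mul_le_mul_of_nonneg_right
      (Finset.single_le_sum (fun i _ => hD0 i) (Finset.mem_univ p)) (hp.nonneg hΓ))

theorem IsDecaying.domDomCongr {ι κ : Type*} (e : ι ≃ κ)
    {T : ContinuousMultilinearMap ℝ (fun _ : ι => Lattice m V) (Lattice m V)}
    (hT : IsDecaying Γ T) : IsDecaying Γ (T.domDomCongr e) := by
  intro R
  obtain ⟨C, hC0, hC⟩ := hT R
  refine ⟨C, hC0, fun v hv p l c hp => hC (fun i => v (e i)) (fun i => hv _) (e.symm p) l c ?_⟩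
  rwa [e.apply_symm_apply]

theorem IsDecayingLin.ofSubsingleton {A : Lattice m V →L[ℝ] Lattice m V} (hA : IsDecayingLin Γ A) :
    IsDecaying Γ (ContinuousMultilinearMap.ofSubsingleton ℝ (Lattice m V) (Lattice m V)
      (0 : Fin 1) A) := by
  intro R
  obtain ⟨C, hC0, hC⟩ := hA
  refine ⟨C, hC0, fun v hv p l c hp => hC l c (v 0) ?_⟩
  rwa [Subsingleton.elim p 0] at hp

/-- `IsDecaying` is uniform only on bounded sets, so `x` is normalized first and linearity restores
its size. -/
theorem isDecayingLin_of_isDecaying {A : Lattice m V →L[ℝ] Lattice m V}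
    {T : ContinuousMultilinearMap ℝ (fun _ : Fin 1 => Lattice m V) (Lattice m V)}
    (hT : IsDecaying Γ T) (hTA : ∀ x, T (fun _ => x) = A x) : IsDecayingLin Γ A := by
  obtain ⟨C, hC0, hC⟩ := hT 1
  refine ⟨C, hC0, fun l c x hx => ?_⟩
  rcases eq_or_ne x 0 with rfl | hx0
  · intro k
    rw [map_zero, mul_assoc]
    exact (hx k).trans' (norm_nonneg _) |> mul_nonneg hC0 |> norm_zero.le.trans
  have hx' : 0 < ‖x‖ := norm_pos_iff.2 hx0
  have h1 := hC (fun _ => ‖x‖⁻¹ • x) (fun _ => by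
    rw [norm_smul, norm_inv, norm_norm, inv_mul_cancel₀ hx'.ne']) 0 l _ (hx.smul ‖x‖⁻¹)
  have h2 := h1.smul ‖x‖
  rw [hTA, map_smul, smul_smul, mul_inv_cancel₀ hx'.ne', one_smul] at h2
  convert h2 using 1
  rw [abs_of_pos hx', abs_of_pos (inv_pos.2 hx')]
  field_simp

/-- The functions that are homogeneous of degree `d`, with a decaying coefficient. -/
def IsHomogeneousDecaying (Γ : (Fin m → ℤ) → ℝ) (d : ℕ) (f : Lattice m V → Lattice m V) : Prop :=
  ∃ T : ContinuousMultilinearMap ℝ (fun _ : Fin d => Lattice m V) (Lattice m V),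
    IsDecaying Γ T ∧ f = fun x => T fun _ => x

/-- The polynomials with decaying coefficients all of whose terms have degree at least `s`. -/
def orderSpace (Γ : (Fin m → ℤ) → ℝ) (V : Type*) [NormedAddCommGroup V] [NormedSpace ℝ V] (s : ℕ) :
    Submodule ℝ (Lattice m V → Lattice m V) :=
  Submodule.span ℝ {f | ∃ d, s ≤ d ∧ IsHomogeneousDecaying Γ d f}

theorem orderSpace_anti {s t : ℕ} (h : s ≤ t) : orderSpace Γ V t ≤ orderSpace Γ V s :=
  Submodule.span_mono fun _ ⟨d, hd, hf⟩ => ⟨d, h.trans hd, hf⟩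

theorem IsDecaying.mem_orderSpace
    {T : ContinuousMultilinearMap ℝ (fun _ : Fin n => Lattice m V) (Lattice m V)}
    (hT : IsDecaying Γ T) {s : ℕ} (hs : s ≤ n) : (fun x => T fun _ => x) ∈ orderSpace Γ V s :=
  Submodule.subset_span ⟨n, hs, T, hT, rfl⟩

theorem IsDecayingLin.mem_orderSpace {A : Lattice m V →L[ℝ] Lattice m V}
    (hA : IsDecayingLin Γ A) : (fun x => A x) ∈ orderSpace Γ V 1 :=
  hA.ofSubsingleton.mem_orderSpace le_rfl

/-- Substitution of polynomials into a decaying multilinear map adds the orders. -/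
theorem IsDecaying.comp_mem_orderSpace (hΓ : IsDecayFunction Γ)
    {T : ContinuousMultilinearMap ℝ (fun _ : Fin n => Lattice m V) (Lattice m V)}
    (hT : IsDecaying Γ T) {a : Fin n → ℕ} {f : Fin n → Lattice m V → Lattice m V}
    (hf : ∀ q, f q ∈ orderSpace Γ V (a q)) :
    (fun x => T fun q => f q x) ∈ orderSpace Γ V (∑ q, a q) := by
  classical
  -- The slots are reduced to homogeneous generators one at a time: those outside `s` are already
  -- homogeneous, and those in `s` are arbitrary.
  have key : ∀ (s : Finset (Fin n)) (f : Fin n → Lattice m V → Lattice m V),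
      (∀ q ∈ s, f q ∈ orderSpace Γ V (a q)) →
      (∀ q ∉ s, ∃ d, a q ≤ d ∧ IsHomogeneousDecaying Γ d (f q)) →
      (fun x => T fun q => f q x) ∈ orderSpace Γ V (∑ q, a q) := by
    intro s
    induction s using Finset.induction_on with
    | empty =>
      intro f _ hf
      choose d had S hS hfS using fun q => hf q (Finset.notMem_empty q)
      have h1 := ((IsDecaying.compMultilinear hΓ hT hS).domDomCongr
        finSigmaFinEquiv).mem_orderSpace (Finset.sum_le_sum fun q (_ : q ∈ Finset.univ) => had q)
      convert h1 using 1
      funext x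
      simp only [hfS]
      rfl
    | insert p s hp ih =>
      intro f hfs hf
      have hg : ∀ g ∈ orderSpace Γ V (a p),
          (fun x => T fun q => Function.update f p g q x) ∈ orderSpace Γ V (∑ q, a q) := by
        have hupd : ∀ g x, (fun q => Function.update f p g q x) =
            Function.update (fun q => f q x) p (g x) := by
          intro g x
          funext q
          rcases eq_or_ne q p with rfl | hq
          · rw [Function.update_self, Function.update_self]
          · rw [Function.update_of_ne hq, Function.update_of_ne hq]
        intro g hg
        induction hg using Submodule.span_induction with
        | mem g hg =>
          refine ih _ (fun q hq => ?_) fun q hq => ?_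
          · rw [Function.update_of_ne (ne_of_mem_of_not_mem hq hp)]
            exact hfs q (Finset.mem_insert_of_mem hq)
          · rcases eq_or_ne q p with rfl | hqp
            · rw [Function.update_self]
              exact hg
            · rw [Function.update_of_ne hqp]
              exact hf q fun h => (Finset.mem_insert.1 h).elim hqp hq
        | zero =>
          convert Submodule.zero_mem _ using 1
          funext x
          exact T.map_coord_zero p (by rw [Function.update_self]; rfl)
        | add g g' _ _ ihg ihg' =>
          convert Submodule.add_mem _ ihg ihg' using 1
          funext x
          simp only [hupd, Pi.add_apply, T.map_update_add]
        | smul c g _ ihg =>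
          convert Submodule.smul_mem _ c ihg using 1
          funext x
          simp only [hupd, Pi.smul_apply, T.map_update_smul]
      have := hg (f p) (hfs p (Finset.mem_insert_self p s))
      rwa [Function.update_eq_self] at this
  exact key Finset.univ f (fun q _ => hf q) fun q hq => absurd (Finset.mem_univ q) hq

/-- In the multilinear expansion each remaining term has at least one factor `w`, of order `b`, and
`n - 1` further factors of order at least `1`; the total order is at least `b + n - 1`. -/
theorem IsDecaying.diagonal_add_sub_mem_orderSpace (hΓ : IsDecayFunction Γ)
    {T : ContinuousMultilinearMap ℝ (fun _ : Fin n => Lattice m V) (Lattice m V)}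
    (hT : IsDecaying Γ T) {b c : ℕ} (hb : 1 ≤ b) (hc : c + 1 ≤ b + n)
    {u w : Lattice m V → Lattice m V} (hu : u ∈ orderSpace Γ V 1) (hw : w ∈ orderSpace Γ V b) :
    (fun x => T (fun _ => u x + w x) - T fun _ => u x) ∈ orderSpace Γ V c := by
  classical
  have hsum : (fun x => T (fun _ => u x + w x) - T fun _ => u x) =
      ∑ s ∈ Finset.univ.erase (Finset.univ : Finset (Fin n)),
        fun x => T fun q => (s.piecewise (fun _ => u) fun _ => w : Fin n → _ → _) q x := by
    funext x
    have h1 := T.map_add_univ (fun _ => u x) (fun _ => w x)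
    rw [← Finset.add_sum_erase _ _ (Finset.mem_univ Finset.univ), Finset.piecewise_univ] at h1
    have h2 : ((fun _ => u x) + fun _ => w x : Fin n → Lattice m V) = fun _ => u x + w x := rfl
    rw [h2] at h1
    rw [h1, add_sub_cancel_left, Finset.sum_apply]
    refine Finset.sum_congr rfl fun s _ => congrArg T (funext fun q => ?_)
    by_cases hq : q ∈ s
    · rw [Finset.piecewise_eq_of_mem _ _ _ hq, Finset.piecewise_eq_of_mem _ _ _ hq]
    · rw [Finset.piecewise_eq_of_notMem _ _ _ hq, Finset.piecewise_eq_of_notMem _ _ _ hq]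
  rw [hsum]
  refine Submodule.sum_mem _ fun s hs => ?_
  have hle : c ≤ ∑ q, if q ∈ s then 1 else b := by
    obtain ⟨q, hq⟩ : ∃ q, q ∉ s := by
      by_contra! hcon
      exact (Finset.mem_erase.1 hs).1 (Finset.eq_univ_iff_forall.2 hcon)
    rw [← Finset.add_sum_erase _ _ (Finset.mem_univ q), if_neg hq]
    have h1 : ∑ _q ∈ Finset.univ.erase q, 1 ≤ ∑ q ∈ Finset.univ.erase q, if q ∈ s then 1 else b :=
      Finset.sum_le_sum fun q _ => by split_ifs <;> omega
    rw [Finset.sum_const, Finset.card_erase_of_mem (Finset.mem_univ q), Finset.card_univ,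
      Fintype.card_fin, smul_eq_mul, mul_one] at h1
    omega
  refine orderSpace_anti hle (hT.comp_mem_orderSpace hΓ fun q => ?_)
  by_cases hq : q ∈ s
  · rwa [Finset.piecewise_eq_of_mem _ _ _ hq, if_pos hq]
  · rwa [Finset.piecewise_eq_of_notMem _ _ _ hq, if_neg hq]

/-- The leading term of a polynomial of order at least `s`. -/
theorem exists_leading_term {s : ℕ} {f : Lattice m V → Lattice m V} (hf : f ∈ orderSpace Γ V s) :
    ∃ G : ContinuousMultilinearMap ℝ (fun _ : Fin s => Lattice m V) (Lattice m V),
      IsDecaying Γ G ∧ (fun x => f x - G fun _ => x) ∈ orderSpace Γ V (s + 1) := by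
  induction hf using Submodule.span_induction with
  | mem f hf =>
    obtain ⟨d, hd, T, hT, rfl⟩ := hf
    rcases hd.eq_or_lt with rfl | hlt
    · refine ⟨T, hT, ?_⟩
      simp only [sub_self]
      exact Submodule.zero_mem _
    · refine ⟨0, isDecaying_zero, ?_⟩
      convert hT.mem_orderSpace hlt using 1
      funext x
      exact sub_zero _
  | zero =>
    refine ⟨0, isDecaying_zero, ?_⟩
    convert Submodule.zero_mem _ using 1
    funext x
    exact sub_zero _
  | add f g _ _ ihf ihg =>
    obtain ⟨G, hG, h⟩ := ihf
    obtain ⟨G', hG', h'⟩ := ihg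
    refine ⟨G + G', hG.add hG', ?_⟩
    convert Submodule.add_mem _ h h' using 1
    funext x
    exact add_sub_add_comm _ _ _ _
  | smul c f _ ihf =>
    obtain ⟨G, hG, h⟩ := ihf
    refine ⟨c • G, hG.smul c, ?_⟩
    convert Submodule.smul_mem _ c h using 1
    funext x
    exact (smul_sub c (f x) (G fun _ => x)).symm

theorem isLittleO_of_mem_orderSpace {s r : ℕ} (hrs : r < s) {f : Lattice m V → Lattice m V}
    (hf : f ∈ orderSpace Γ V s) : f =o[𝓝 0] fun x => ‖x‖ ^ r := by
  induction hf using Submodule.span_induction with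
  | mem f hf =>
    obtain ⟨d, hd, T, -, rfl⟩ := hf
    have h1 : (fun x : Lattice m V => T fun _ => x) =O[𝓝 0] fun x => ‖x‖ ^ d := by
      refine IsBigO.of_bound ‖T‖ (Eventually.of_forall fun x => ?_)
      rw [norm_pow, norm_norm]
      exact norm_apply_le_of_forall_le fun _ => le_rfl
    exact h1.trans_isLittleO ((isLittleO_pow_pow (𝕜 := ℝ) (hrs.trans_le hd)).comp_tendsto
      (tendsto_norm_zero (E := Lattice m V)))
  | zero => exact isLittleO_zero _ _
  | add f g _ _ ihf ihg => exact ihf.add ihg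
  | smul c f _ ihf => exact ihf.const_smul_left c

end Order

/-! ### Order-by-order construction of the conjugacy and the normal form. -/

section NormalForm

set_option linter.unusedSectionVars false

variable {m : ℕ} {V : Type*} [NormedAddCommGroup V] [NormedSpace ℝ V] {Γ : (Fin m → ℤ) → ℝ}

theorem sum_range_succ_eq_add_sum_Icc {M : Type*} [AddCommMonoid M] (f : ℕ → M) {r : ℕ}
    (hr : 1 ≤ r) : ∑ j ∈ Finset.range (r + 1), f j = f 0 + (f 1 + ∑ j ∈ Finset.Icc 2 r, f j) := by
  rw [Finset.range_eq_Ico, Finset.sum_eq_sum_Ico_succ_bot (by omega),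
    Finset.sum_eq_sum_Ico_succ_bot (by omega)]
  rfl

/-- The polynomial `L x + ∑_{j=2}^r k_j x^{⊗j}`. -/
def perturbation (L : Lattice m V →L[ℝ] Lattice m V)
    (k : ∀ j : ℕ, ContinuousMultilinearMap ℝ (fun _ : Fin j => Lattice m V) (Lattice m V)) (r : ℕ)
    (x : Lattice m V) : Lattice m V :=
  L x + ∑ j ∈ Finset.Icc 2 r, k j fun _ => x

variable {L : Lattice m V →L[ℝ] Lattice m V}
  {k : ∀ j : ℕ, ContinuousMultilinearMap ℝ (fun _ : Fin j => Lattice m V) (Lattice m V)} {r : ℕ}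

theorem perturbation_zero : perturbation L k r 0 = 0 := by
  rw [perturbation, map_zero, zero_add]
  refine Finset.sum_eq_zero fun j hj => (k j).map_coord_zero ⟨0, ?_⟩ rfl
  have := (Finset.mem_Icc.1 hj).1
  omega

theorem sum_mem_orderSpace_two (hk : ∀ j, IsDecaying Γ (k j)) :
    (fun x => ∑ j ∈ Finset.Icc 2 r, k j fun _ => x) ∈ orderSpace Γ V 2 := by
  have h1 : (∑ j ∈ Finset.Icc 2 r, fun x => k j fun _ => x) ∈ orderSpace Γ V 2 :=
    Submodule.sum_mem _ fun j hj => (hk j).mem_orderSpace (Finset.mem_Icc.1 hj).1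
  convert h1 using 1
  funext x
  rw [Finset.sum_apply]

theorem perturbation_mem_orderSpace (hL : IsDecayingLin Γ L) (hk : ∀ j, IsDecaying Γ (k j)) :
    perturbation L k r ∈ orderSpace Γ V 1 :=
  Submodule.add_mem _ hL.mem_orderSpace
    (orderSpace_anti one_le_two (sum_mem_orderSpace_two hk))

theorem hasFDerivAt_perturbation (hk : ∀ j, IsDecaying Γ (k j)) :
    HasFDerivAt (perturbation L k r) L 0 := by
  rw [hasFDerivAt_iff_isLittleO_nhds_zero]
  have h1 := isLittleO_of_mem_orderSpace one_lt_two (sum_mem_orderSpace_two (r := r) hk)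
  simp only [pow_one] at h1
  refine (isLittleO_norm_right.1 h1).congr_left fun x => ?_
  rw [zero_add, perturbation_zero, sub_zero, perturbation, add_sub_cancel_left]

theorem isGammaPolynomial_perturbation (hΓ : IsDecayFunction Γ) (hr : 1 ≤ r)
    (hL : IsDecayingLin Γ L) (hk : ∀ j, IsDecaying Γ (k j)) :
    IsGammaPolynomial Γ r (perturbation L k r) := by
  refine ⟨fun j => match j with
    | 0 => 0
    | 1 => ContinuousMultilinearMap.ofSubsingleton ℝ (Lattice m V) (Lattice m V) (0 : Fin 1) L
    | j + 2 => k (j + 2), fun j => ?_, fun x => ?_⟩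
  · match j with
    | 0 => exact isDecaying_zero.mem_LGammaMulti hΓ
    | 1 => exact hL.ofSubsingleton.mem_LGammaMulti hΓ
    | j + 2 => exact (hk (j + 2)).mem_LGammaMulti hΓ
  · rw [sum_range_succ_eq_add_sum_Icc _ hr]
    refine (congrArg (L x + ·) ?_).trans (zero_add _).symm
    refine Finset.sum_congr rfl fun j hj => ?_
    obtain ⟨i, rfl⟩ := Nat.exists_eq_add_of_le' (Finset.mem_Icc.1 hj).1
    rfl

/-- Formal normalization: the conjugacy equation can be solved up to every order, with a normal
form that contains only the terms of the orders in `J`. -/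
theorem exists_formal_conjugacy (hΓ : IsDecayFunction Γ) {A : Lattice m V →L[ℝ] Lattice m V}
    (hA : IsDecayingLin Γ A)
    {p : ∀ j : ℕ, ContinuousMultilinearMap ℝ (fun _ : Fin j => Lattice m V) (Lattice m V)}
    (hp : ∀ j, IsDecaying Γ (p j)) {J : Finset ℕ}
    (hJ : ∀ j ∈ Finset.Icc 2 r, j ∉ J →
      ∀ G : ContinuousMultilinearMap ℝ (fun _ : Fin j => Lattice m V) (Lattice m V),
        IsDecaying Γ G →
        ∃ T : ContinuousMultilinearMap ℝ (fun _ : Fin j => Lattice m V) (Lattice m V),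
          IsDecaying Γ T ∧ ∀ v, A (T v) - T (fun q => A (v q)) = G v)
    {s : ℕ} (hs : 1 ≤ s) (hsr : s ≤ r) :
    ∃ k h : ∀ j : ℕ, ContinuousMultilinearMap ℝ (fun _ : Fin j => Lattice m V) (Lattice m V),
      (∀ j, IsDecaying Γ (k j)) ∧ (∀ j, IsDecaying Γ (h j)) ∧ (∀ j ∉ J, h j = 0) ∧
      (fun x => perturbation A p r (perturbation (ContinuousLinearMap.id ℝ _) k s x) -
        perturbation (ContinuousLinearMap.id ℝ _) k s (perturbation A h s x)) ∈
          orderSpace Γ V (s + 1) := by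
  induction s, hs using Nat.le_induction with
  | base =>
    refine ⟨fun _ => 0, fun _ => 0, fun _ => isDecaying_zero, fun _ => isDecaying_zero,
      fun _ _ => rfl, ?_⟩
    convert sum_mem_orderSpace_two (r := r) hp using 1
    funext x
    simp [perturbation]
  | succ s hs ih =>
    obtain ⟨k, h, hk, hh, hhJ, hR⟩ := ih (by omega)
    obtain ⟨G, hG, hRG⟩ := exists_leading_term hR
    -- At a resonant order the term `G` is absorbed into the normal form; otherwise it is removed by
    -- the homological equation with right-hand side `-G`.
    obtain ⟨T, η, hT, hη, hηJ, hTη⟩ : ∃ T η : ContinuousMultilinearMap ℝ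
        (fun _ : Fin (s + 1) => Lattice m V) (Lattice m V), IsDecaying Γ T ∧ IsDecaying Γ η ∧
        (s + 1 ∉ J → η = 0) ∧ ∀ v, G v + A (T v) - η v - T (fun q => A (v q)) = 0 := by
      by_cases hsJ : s + 1 ∈ J
      · refine ⟨0, G, isDecaying_zero, hG, fun h => absurd hsJ h, fun v => ?_⟩
        simp
      · obtain ⟨T, hT, hTG⟩ := hJ (s + 1) (Finset.mem_Icc.2 ⟨by omega, hsr⟩) hsJ _ (hG.smul (-1))
        refine ⟨T, 0, hT, isDecaying_zero, fun _ => rfl, fun v => ?_⟩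
        have h1 := hTG v
        rw [smul_apply, neg_one_smul] at h1
        rw [zero_apply, sub_zero, add_sub_assoc, h1, add_neg_cancel]
    have hnot : s + 1 ∉ Finset.Icc 2 s := by simp
    have hext : ∀ (L : Lattice m V →L[ℝ] Lattice m V)
        (k : ∀ j : ℕ, ContinuousMultilinearMap ℝ (fun _ : Fin j => Lattice m V) (Lattice m V))
        (T : ContinuousMultilinearMap ℝ (fun _ : Fin (s + 1) => Lattice m V) (Lattice m V)) (x),
        perturbation L (Function.update k (s + 1) T) (s + 1) x =
          perturbation L k s x + T fun _ => x := by
      intro L k T x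
      rw [perturbation, perturbation, Finset.sum_Icc_succ_top (by omega), Function.update_self,
        add_assoc]
      refine congrArg₂ _ rfl (congrArg₂ _ (Finset.sum_congr rfl fun j hj => ?_) rfl)
      rw [Function.update_of_ne (ne_of_mem_of_not_mem hj hnot)]
    have hupd : ∀ {k : ∀ j : ℕ, ContinuousMultilinearMap ℝ (fun _ : Fin j => Lattice m V)
        (Lattice m V)} {T : ContinuousMultilinearMap ℝ (fun _ : Fin (s + 1) => Lattice m V)
        (Lattice m V)}, (∀ j, IsDecaying Γ (k j)) → IsDecaying Γ T →
        ∀ j, IsDecaying Γ (Function.update k (s + 1) T j) := by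
      intro k T hk hT j
      rcases eq_or_ne j (s + 1) with rfl | hj
      · rwa [Function.update_self]
      · rw [Function.update_of_ne hj]
        exact hk j
    refine ⟨Function.update k (s + 1) T, Function.update h (s + 1) η, hupd hk hT, hupd hh hη,
      fun j hj => ?_, ?_⟩
    · rcases eq_or_ne j (s + 1) with rfl | hjs
      · rw [Function.update_self]
        exact hηJ hj
      · rw [Function.update_of_ne hjs]
        exact hhJ j hj
    set K := perturbation (ContinuousLinearMap.id ℝ _) k s with hK
    set H := perturbation A h s with hH
    have hK1 : K ∈ orderSpace Γ V 1 := perturbation_mem_orderSpace isDecayingLin_id hk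
    have hH1 : H ∈ orderSpace Γ V 1 := perturbation_mem_orderSpace hA hh
    have hT1 : (fun x => T fun _ => x) ∈ orderSpace Γ V (s + 1) := hT.mem_orderSpace le_rfl
    have hη1 : (fun x => η fun _ => x) ∈ orderSpace Γ V (s + 1) := hη.mem_orderSpace le_rfl
    have hη2 : (fun x => (∑ j ∈ Finset.Icc 2 s, h j fun _ => x) + η fun _ => x) ∈
        orderSpace Γ V 2 :=
      Submodule.add_mem _ (sum_mem_orderSpace_two hh) (hη.mem_orderSpace (by omega))
    -- The three errors have order at least `s + 2`: `T` inside the nonlinear part of `P`, `η`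
    -- inside the nonlinear part of `K`, and `T` evaluated at `H + η` instead of `A`.
    have e1 : (∑ j ∈ Finset.Icc 2 r, fun x => p j (fun _ => K x + T fun _ => x) -
        p j fun _ => K x) ∈ orderSpace Γ V (s + 1 + 1) :=
      Submodule.sum_mem _ fun j hj => (hp j).diagonal_add_sub_mem_orderSpace hΓ (by omega)
        (by have := (Finset.mem_Icc.1 hj).1; omega) hK1 hT1
    have e2 : (∑ j ∈ Finset.Icc 2 s, fun x => k j (fun _ => H x + η fun _ => x) -
        k j fun _ => H x) ∈ orderSpace Γ V (s + 1 + 1) :=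
      Submodule.sum_mem _ fun j hj => (hk j).diagonal_add_sub_mem_orderSpace hΓ (by omega)
        (by have := (Finset.mem_Icc.1 hj).1; omega) hH1 hη1
    have e3 : (fun x => T (fun _ => A x + ((∑ j ∈ Finset.Icc 2 s, h j fun _ => x) + η fun _ => x)) -
        T fun _ => A x) ∈ orderSpace Γ V (s + 1 + 1) :=
      hT.diagonal_add_sub_mem_orderSpace hΓ (b := 2) (by omega) (by omega) hA.mem_orderSpace hη2
    -- The new defect is the old one without its leading term, plus `e1`, minus `e2` and `e3`; the
    -- degree `s + 1` terms cancel by `hTη`.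
    convert Submodule.sub_mem _ (Submodule.sub_mem _ (Submodule.add_mem _ hRG e1) e2) e3 using 1
    funext x
    have e4 := hTη fun _ => x
    simp only [hext, ← hK, ← hH, Pi.sub_apply, Pi.add_apply, Finset.sum_apply, Finset.sum_sub_distrib]
    have e5 : ∀ y z, perturbation A p r (y + z) = perturbation A p r y + A z +
        (∑ j ∈ Finset.Icc 2 r, p j (fun _ => y + z) - ∑ j ∈ Finset.Icc 2 r, p j fun _ => y) := by
      intro y z
      rw [perturbation, perturbation, map_add]
      abel
    have e6 : ∀ y z, K (y + z) = K y + z +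
        (∑ j ∈ Finset.Icc 2 s, k j (fun _ => y + z) - ∑ j ∈ Finset.Icc 2 s, k j fun _ => y) := by
      intro y z
      rw [hK, perturbation, perturbation, map_add]
      change y + z + _ = y + _ + z + _
      abel
    have e7 : A x + ((∑ j ∈ Finset.Icc 2 s, h j fun _ => x) + η fun _ => x) =
        H x + η fun _ => x := by
      rw [hH, perturbation, add_assoc]
    rw [e5, e6, e7, ← sub_eq_zero, ← e4]
    abel

end NormalForm

end LatticeDecay

end

/-! ### The theorem and its corollary. -/

theorem mainTheorem5 {m : ℕ} {V : Type*} [NormedAddCommGroup V] [NormedSpace ℝ V]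
    [FiniteDimensional ℝ V] (Γ : (Fin m → ℤ) → ℝ) (hΓ : LatticeDecay.IsDecayFunction Γ)
    (r : ℕ) (hr : 1 ≤ r)
    (U : Set (LatticeDecay.Lattice m V)) (hU : IsOpen U) (h0U : (0 : LatticeDecay.Lattice m V) ∈ U)
    (F : LatticeDecay.Lattice m V → LatticeDecay.Lattice m V)
    (hF : LatticeDecay.IsCGammaOn Γ r U F) (hF0 : F 0 = 0)
    (A : LatticeDecay.Lattice m V →L[ℝ] LatticeDecay.Lattice m V)
    (hA : HasFDerivAt F A 0) (hAinv : A.IsInvertible) :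
    (∃ K H : LatticeDecay.Lattice m V → LatticeDecay.Lattice m V,
      LatticeDecay.IsGammaPolynomial Γ r K ∧ LatticeDecay.IsCInftyGamma Γ K ∧
      LatticeDecay.IsGammaPolynomial Γ r H ∧ LatticeDecay.IsCInftyGamma Γ H ∧
      K 0 = 0 ∧ HasFDerivAt K (ContinuousLinearMap.id ℝ (LatticeDecay.Lattice m V)) 0 ∧
      (fun x => F (K x) - K (H x)) =o[𝓝 0] (fun x => ‖x‖ ^ r) ∧
      ∃ h : ∀ j : ℕ, ContinuousMultilinearMap ℝ
          (fun _ : Fin j => LatticeDecay.Lattice m V) (LatticeDecay.Lattice m V),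
        (∀ j ∈ LatticeDecay.resonantOrders Γ A r, h j ∈ LatticeDecay.LGammaMulti Γ j) ∧
        ∀ x, H x = A x + ∑ j ∈ LatticeDecay.resonantOrders Γ A r, h j (fun _ => x)) ∧
    ((∀ j : ℕ, 2 ≤ j → j ≤ r →
        LatticeDecay.specGamma Γ A ^ j ∩ LatticeDecay.specGamma Γ A = ∅) →
      ∃ K : LatticeDecay.Lattice m V → LatticeDecay.Lattice m V,
        LatticeDecay.IsGammaPolynomial Γ r K ∧ LatticeDecay.IsCInftyGamma Γ K ∧
        K 0 = 0 ∧ HasFDerivAt K (ContinuousLinearMap.id ℝ (LatticeDecay.Lattice m V)) 0 ∧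
        (fun x => F (K x) - K (A x)) =o[𝓝 0] (fun x => ‖x‖ ^ r)) := by
  -- Finite dimension enters only through completeness.
  have : CompleteSpace V := FiniteDimensional.complete ℝ V
  have hnhds : U ∈ 𝓝 (0 : LatticeDecay.Lattice m V) := hU.mem_nhds h0U
  have hFr : ContDiffAt ℝ r F 0 := hF.1.contDiffAt hnhds
  set D := fun k : ℕ => iteratedFDeriv ℝ k F 0 with hD
  have hDdec : ∀ k, 1 ≤ k → k ≤ r → LatticeDecay.IsDecaying Γ (D k) := fun k h1 h2 =>
    LatticeDecay.isDecaying_of_mem_LGammaMulti hΓ ((hF.2.2 k h1 h2).1 0 h0U)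
  have hD1 : ∀ x, D 1 (fun _ => x) = A x := fun x => by
    rw [hD]
    dsimp only
    rw [iteratedFDeriv_one_apply, hA.fderiv]
  have hAdec : LatticeDecay.IsDecayingLin Γ A :=
    LatticeDecay.isDecayingLin_of_isDecaying (hDdec 1 le_rfl hr) hD1
  classical
  -- These are the Taylor coefficients, set to zero outside `1 ≤ j ≤ r` so that all of them decay;
  -- only those with `2 ≤ j ≤ r` enter `perturbation`.
  set p : ∀ j : ℕ, ContinuousMultilinearMap ℝ (fun _ : Fin j => LatticeDecay.Lattice m V)
    (LatticeDecay.Lattice m V) := fun j =>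
      if 1 ≤ j ∧ j ≤ r then ((j.factorial : ℝ)⁻¹) • D j else 0 with hp
  have hpdec : ∀ j, LatticeDecay.IsDecaying Γ (p j) := fun j => by
    rw [hp]
    dsimp only
    split_ifs with h
    · exact (hDdec j h.1 h.2).smul _
    · exact LatticeDecay.isDecaying_zero
  have htaylor : (fun x => F x - LatticeDecay.perturbation A p r x) =o[𝓝 0] fun x => ‖x‖ ^ r := by
    refine (LatticeDecay.taylor_isLittleO_norm_pow r hFr).congr_left fun x => ?_
    rw [LatticeDecay.sum_range_succ_eq_add_sum_Icc _ hr, LatticeDecay.perturbation]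
    congr 1
    rw [iteratedFDeriv_zero_apply, hF0, smul_zero, zero_add]
    congr 1
    · rw [Nat.factorial_one, Nat.cast_one, inv_one, one_smul]
      exact hD1 x
    · refine Finset.sum_congr rfl fun j hj => ?_
      rw [Finset.mem_Icc] at hj
      rw [hp]
      dsimp only
      rw [if_pos ⟨by omega, hj.2⟩]
      rfl
  obtain ⟨k, h, hk, hh, hhJ, hconj⟩ := LatticeDecay.exists_formal_conjugacy hΓ hAdec hpdec
    (J := LatticeDecay.resonantOrders Γ A r) (r := r) (fun j hj hjJ G hG =>
      LatticeDecay.exists_sylvester hΓ hAdec (by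
        rw [← Set.not_nonempty_iff_eq_empty]
        exact fun hne => hjJ (Finset.mem_filter.2 ⟨hj, hne⟩)) hG) hr le_rfl
  set K := LatticeDecay.perturbation (ContinuousLinearMap.id ℝ (LatticeDecay.Lattice m V)) k r
  have hK0 : K 0 = 0 := LatticeDecay.perturbation_zero
  have hK' : HasFDerivAt K (ContinuousLinearMap.id ℝ (LatticeDecay.Lattice m V)) 0 :=
    LatticeDecay.hasFDerivAt_perturbation hk
  have hKpoly : LatticeDecay.IsGammaPolynomial Γ r K :=
    LatticeDecay.isGammaPolynomial_perturbation hΓ hr LatticeDecay.isDecayingLin_id hk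
  have hHpoly : LatticeDecay.IsGammaPolynomial Γ r (LatticeDecay.perturbation A h r) :=
    LatticeDecay.isGammaPolynomial_perturbation hΓ hr hAdec hh
  have hKO : (fun x => ‖K x‖ ^ r) =O[𝓝 0] fun x => ‖x‖ ^ r := by
    have h1 := hK'.isBigO_sub
    simp only [hK0, sub_zero] at h1
    exact h1.norm_norm.pow r
  have hKt : Tendsto K (𝓝 0) (𝓝 0) := by
    have h1 := hK'.continuousAt.tendsto
    rwa [hK0] at h1
  have hmain : (fun x => F (K x) - K (LatticeDecay.perturbation A h r x)) =o[𝓝 0]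
      fun x => ‖x‖ ^ r := by
    -- The splitting is `F ∘ K - K ∘ H = (F - P) ∘ K + (P ∘ K - K ∘ H)`; the first remainder stays
    -- `o(‖x‖ ^ r)` because `K x = O(‖x‖)`.
    have h1 := ((htaylor.comp_tendsto hKt).trans_isBigO hKO).add
      (LatticeDecay.isLittleO_of_mem_orderSpace (Nat.lt_succ_self r) hconj)
    refine h1.congr_left fun x => ?_
    exact sub_add_sub_cancel _ _ _
  have hH : ∀ x, LatticeDecay.perturbation A h r x =
      A x + ∑ j ∈ LatticeDecay.resonantOrders Γ A r, h j fun _ => x := fun x => by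
    rw [LatticeDecay.perturbation]
    congr 1
    -- The coefficients `h j` vanish off the resonant orders, so the sum over `2 ≤ j ≤ r` shrinks to
    -- them.
    refine (Finset.sum_subset (Finset.filter_subset _ _) fun j _ hj => ?_).symm
    rw [hhJ j hj]
    rfl
  refine ⟨⟨K, LatticeDecay.perturbation A h r, hKpoly, hKpoly.isCInftyGamma hΓ, hHpoly,
    hHpoly.isCInftyGamma hΓ, hK0, hK', hmain, h,
    fun j _ => (hh j).mem_LGammaMulti hΓ, hH⟩, fun hnon => ⟨K, hKpoly, hKpoly.isCInftyGamma hΓ,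
    hK0, hK', ?_⟩⟩
  have hJ : LatticeDecay.resonantOrders Γ A r = ∅ := by
    refine Finset.filter_eq_empty_iff.2 fun j hj => ?_
    rw [Finset.mem_Icc] at hj
    rw [hnon j hj.1 hj.2]
    exact Set.not_nonempty_empty
  refine hmain.congr_left fun x => ?_
  rw [hH, hJ, Finset.sum_empty, add_zero]
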